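/- Let $p$ be a prime and let $H=\mathrm{Dist}(SL_2)$ be the $\mathbb{F}_p$-algebra of distributions supported at $1$ on the algebraic group $SL_2$ over $\mathbb{F}_p$: the linear functionals on $\mathbb{F}_p[SL_2]$ that vanish on some power of the ideal of functions vanishing at $1$, with the convolution product $(\mu\nu)(\varphi)=(\mu\otimes\nu)(\Delta\varphi)$. For $m\ge 0$ let $e^{(m)},f^{(m)}\in H$ be the divided powers of the standard root vectors, i.e. $e^{(m)}$ (resp. $f^{(m)}$) sends $\varphi$ to the coefficient of $t^m$ in $\varphi\begin{pmatrix}1&t\\0&1\end{pmatrix}$ (resp. $\varphi\begin{pmatrix}1&0\\t&1\end{pmatrix}$). Consider the following relations in symbols $e^{(p^k)},f^{(p^k)}$ ($k\ge 0$), where $X_k:=[e^{(p^k)},f^{(p^k)}]$ and the relations are imposed for all $k\ge0$ and $n>0$: 1. $[X_k,e^{(p^k)}]=2e^{(p^k)}$, $[X_k,f^{(p^k)}]=-2f^{(p^k)}$; 2. $[X_k,e^{(p^{k+n})}]=0=[X_k,f^{(p^{k+n})}]$; 3. $[e^{(p^k)},e^{(p^{k+n})}]=0=[f^{(p^k)},f^{(p^{k+n})}]$;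 4. $[e^{(p^k)},f^{(p^{k+n})}]=(-1)^n(f^{(p^k)})^{p-1}(f^{(p^{k+1})})^{p-1}\cdots(f^{(p^{k+n-1})})^{p-1}(X_k+1)$ and $[e^{(p^{k+n})},f^{(p^k)}]=(-1)^n(X_k+1)(e^{(p^k)})^{p-1}(e^{(p^{k+1})})^{p-1}\cdots(e^{(p^{k+n-1})})^{p-1}$; 5. $(e^{(p^k)})^p=0=(f^{(p^k)})^p$; 6. $X_k^p=X_k$. Let $H'$ be the (abstract) associative unital $\mathbb{F}_p$-algebra generated by these symbols subject to relations 1–6. Proposition (Sufficiency of the relations). Suppose that relations 1–6 hold in $H$. Then the canonical algebra homomorphism $H'\to H$, which sends each symbol to the element of $H$ of the same name, is an isomorphism; that is, $H$ is generated by the elements $e^{(p^k)},f^{(p^k)}$ ($k\ge0$) subject only to relations 1–6. Moreover, the monomials $$f^{a_0}\cdots(f^{(p^n)})^{a_n}\,X_0^{b_0}\cdots X_n^{b_n}\,(e^{(p^n)})^{c_n}\cdots e^{c_0},\qquad 0\le a_i,b_i,c_i<p,$$ one for each triple of finitely supported sequences $(a_i),(b_i),(c_i)$, span $H'$, and their images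 form a basis of $H$. -/

import Mathlib

open scoped TensorProduct

noncomputable section

namespace SL2Dist

/-! ### The coordinate ring of `SL₂` over a commutative ring `R` -/

section Coordinate

variable (R : Type) [CommRing R]

/-- The coordinate ring `R[x₀₀, x₀₁, x₁₀, x₁₁] / (det - 1)` of the group scheme `SL₂` over `R`. -/
def Coord : Type :=
  MvPolynomial (Fin 2 × Fin 2) R ⧸
    Ideal.span {(Matrix.mvPolynomialX (Fin 2) (Fin 2) R).det - 1}

instance : CommRing (Coord R) := inferInstanceAs (CommRing (_ ⧸ _))

instance : Algebra R (Coord R) := inferInstanceAs (Algebra R (_ ⧸ _))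

/-- The quotient map from polynomials in the matrix entries to functions on `SL₂`. -/
def Coord.mk : MvPolynomial (Fin 2 × Fin 2) R →ₐ[R] Coord R :=
  Ideal.Quotient.mkₐ R (Ideal.span {(Matrix.mvPolynomialX (Fin 2) (Fin 2) R).det - 1})

/-- The universal point of `SL₂`: the matrix of the coordinate functions `x_{ij}`. -/
def univMatrix : Matrix (Fin 2) (Fin 2) (Coord R) :=
  (Matrix.mvPolynomialX (Fin 2) (Fin 2) R).map (Coord.mk R)

theorem univMatrix_det : (univMatrix R).det = 1 := by
  have h := AlgHom.map_det (Coord.mk R) (Matrix.mvPolynomialX (Fin 2) (Fin 2) R)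
  have h' : Coord.mk R ((Matrix.mvPolynomialX (Fin 2) (Fin 2) R).det - 1) = 0 :=
    Ideal.Quotient.eq_zero_iff_mem.mpr (Ideal.subset_span rfl)
  rw [map_sub, map_one, sub_eq_zero, h] at h'
  exact h'

variable {R}

/-- An `S`-valued point of `SL₂`, that is, a `2 × 2` matrix over `S` of determinant one, seen as
the `R`-algebra homomorphism `R[SL₂] → S` which evaluates functions at that point. -/
def evalAt {S : Type} [CommRing S] [Algebra R S] (M : Matrix (Fin 2) (Fin 2) S) (hM : M.det = 1) :
    Coord R →ₐ[R] S :=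
  Ideal.Quotient.liftₐ _ (MvPolynomial.aeval fun ij : Fin 2 × Fin 2 => M ij.1 ij.2) (by
    intro a ha
    have hle : Ideal.span {(Matrix.mvPolynomialX (Fin 2) (Fin 2) R).det - 1} ≤
        RingHom.ker (MvPolynomial.aeval (R := R) fun ij : Fin 2 × Fin 2 => M ij.1 ij.2) := by
      rw [Ideal.span_le, Set.singleton_subset_iff]
      rw [Matrix.det_fin_two] at hM
      simp [Matrix.det_fin_two, hM]
    exact hle ha)

theorem evalAt_univMatrix {S : Type} [CommRing S] [Algebra R S] (M : Matrix (Fin 2) (Fin 2) S)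
    (hM : M.det = 1) (i j : Fin 2) : evalAt (R := R) M hM (univMatrix R i j) = M i j := by
  simp only [evalAt, univMatrix, Matrix.map_apply, Matrix.mvPolynomialX_apply]
  exact (Ideal.Quotient.lift_mk _ _ _).trans (MvPolynomial.aeval_X _ _)

theorem coord_hom_ext {S : Type} [Semiring S] [Algebra R S] {f g : Coord R →ₐ[R] S}
    (h : ∀ i j, f (univMatrix R i j) = g (univMatrix R i j)) : f = g := by
  apply Ideal.Quotient.algHom_ext
  apply MvPolynomial.algHom_ext
  rintro ⟨i, j⟩
  have := h i j
  rw [univMatrix, Matrix.map_apply, Matrix.mvPolynomialX_apply] at this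
  exact this

variable (R)

/-- Comultiplication `x_{ij} ↦ ∑ₖ x_{ik} ⊗ x_{kj}`, dual to matrix multiplication. -/
def comulHom : Coord R →ₐ[R] Coord R ⊗[R] Coord R :=
  evalAt
    ((univMatrix R).map (Algebra.TensorProduct.includeLeft (R := R) (S := R)) *
      (univMatrix R).map (Algebra.TensorProduct.includeRight (R := R)))
    (by
      have h1 := AlgHom.map_det
        (Algebra.TensorProduct.includeLeft (R := R) (S := R) (A := Coord R) (B := Coord R))
        (univMatrix R)
      have h2 := AlgHom.map_det
        (Algebra.TensorProduct.includeRight (R := R) (A := Coord R) (B := Coord R))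
        (univMatrix R)
      rw [univMatrix_det, map_one] at h1 h2
      rw [Matrix.det_mul]
      erw [← h1, ← h2]
      exact one_mul 1)

theorem comulHom_univMatrix (i j : Fin 2) :
    comulHom R (univMatrix R i j) = ∑ k, univMatrix R i k ⊗ₜ[R] univMatrix R k j := by
  rw [comulHom, evalAt_univMatrix, Matrix.mul_apply]
  simp

/-- Counit: evaluation at the identity matrix. -/
def counitHom : Coord R →ₐ[R] R := evalAt 1 Matrix.det_one

theorem counitHom_univMatrix (i j : Fin 2) :
    counitHom R (univMatrix R i j) = (1 : Matrix (Fin 2) (Fin 2) R) i j :=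
  evalAt_univMatrix _ _ _ _

instance : Bialgebra R (Coord R) :=
  Bialgebra.ofAlgHom (comulHom R) (counitHom R)
    (by
      apply coord_hom_ext
      intro i j
      simp only [AlgHom.comp_apply, comulHom_univMatrix, Fin.sum_univ_two]
      simp [comulHom_univMatrix, Fin.sum_univ_two, TensorProduct.add_tmul, TensorProduct.tmul_add]
      abel)
    (by
      apply coord_hom_ext
      intro i j
      simp only [AlgHom.comp_apply, comulHom_univMatrix, Fin.sum_univ_two]
      fin_cases i <;> simp [counitHom_univMatrix])
    (by
      apply coord_hom_ext
      intro i j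
      simp only [AlgHom.comp_apply, comulHom_univMatrix, Fin.sum_univ_two]
      fin_cases j <;> simp [counitHom_univMatrix])

/-- The augmentation ideal: the functions on `SL₂` that vanish at the identity. -/
def augIdeal : Ideal (Coord R) := RingHom.ker (counitHom R)

end Coordinate

/-! ### The algebra of distributions supported at the identity -/

section Distributions

variable (R : Type) [CommRing R]

theorem comul_aug_mem {y : Coord R} (hy : y ∈ augIdeal R) :
    comulHom R y ∈ (augIdeal R).map
        (Algebra.TensorProduct.includeLeft (R := R) (S := R) (A := Coord R) (B := Coord R)) ⊔
      (augIdeal R).map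
        (Algebra.TensorProduct.includeRight (R := R) (A := Coord R) (B := Coord R)) := by
  have hs : Function.Surjective (counitHom R) := fun r => ⟨algebraMap _ _ r, by simp⟩
  have hk := Algebra.TensorProduct.map_ker (counitHom R) (counitHom R) hs hs
  rw [augIdeal, ← hk, RingHom.mem_ker]
  have hcomp : (Algebra.TensorProduct.map (counitHom R) (counitHom R)).comp (comulHom R) =
      (Algebra.ofId R _).comp (counitHom R) := by
    apply coord_hom_ext
    intro i j
    rw [AlgHom.comp_apply, AlgHom.comp_apply, comulHom_univMatrix, map_sum,
      counitHom_univMatrix, Fin.sum_univ_two, Algebra.TensorProduct.map_tmul,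
      Algebra.TensorProduct.map_tmul]
    simp only [counitHom_univMatrix]
    have h00 : (1 : R) ⊗ₜ[R] (1 : R) = 1 := Algebra.TensorProduct.one_def.symm
    fin_cases i <;> fin_cases j <;> simp [Matrix.one_apply, h00]
  have h0 := DFunLike.congr_fun hcomp y
  have hy0 : counitHom R y = 0 := hy
  rw [AlgHom.comp_apply, AlgHom.comp_apply, hy0, map_zero] at h0
  exact h0

theorem map_left_vanish (μ ν : Coord R →ₗ[R] R) (I : Ideal (Coord R)) (h : ∀ x ∈ I, μ x = 0)
    {z : Coord R ⊗[R] Coord R} (hz : z ∈ I.map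
      (Algebra.TensorProduct.includeLeft (R := R) (S := R) (A := Coord R) (B := Coord R))) :
    TensorProduct.map μ ν z = 0 := by
  suffices H : ∀ w, TensorProduct.map μ ν (w * z) = 0 by simpa using H 1
  induction hz using Submodule.span_induction with
  | mem x hx =>
    obtain ⟨a, ha, rfl⟩ := hx
    intro w
    induction w with
    | zero => simp
    | tmul b c => simp [h _ (I.mul_mem_left b ha)]
    | add u v hu hv => rw [add_mul, map_add, hu, hv, add_zero]
  | zero => simp
  | add x y _ _ hx hy => intro w; rw [mul_add, map_add, hx, hy, add_zero]
  | smul r x _ hx => intro w; rw [smul_eq_mul, ← mul_assoc]; exact hx _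

theorem map_right_vanish (μ ν : Coord R →ₗ[R] R) (I : Ideal (Coord R)) (h : ∀ x ∈ I, ν x = 0)
    {z : Coord R ⊗[R] Coord R} (hz : z ∈ I.map
      (Algebra.TensorProduct.includeRight (R := R) (A := Coord R) (B := Coord R))) :
    TensorProduct.map μ ν z = 0 := by
  suffices H : ∀ w, TensorProduct.map μ ν (w * z) = 0 by simpa using H 1
  induction hz using Submodule.span_induction with
  | mem x hx =>
    obtain ⟨a, ha, rfl⟩ := hx
    intro w
    induction w with
    | zero => simp
    | tmul b c => simp [h _ (I.mul_mem_left c ha)]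
    | add u v hu hv => rw [add_mul, map_add, hu, hv, add_zero]
  | zero => simp
  | add x y _ _ hx hy => intro w; rw [mul_add, map_add, hx, hy, add_zero]
  | smul r x _ hx => intro w; rw [smul_eq_mul, ← mul_assoc]; exact hx _

theorem conv_vanish (μ ν : Coord R →ₗ[R] R) (m n : ℕ) (hμ : ∀ x ∈ augIdeal R ^ m, μ x = 0)
    (hν : ∀ x ∈ augIdeal R ^ n, ν x = 0) (x : Coord R) (hx : x ∈ augIdeal R ^ (m + n)) :
    TensorProduct.map μ ν (comulHom R x) = 0 := by
  have h1 : comulHom R x ∈ ((augIdeal R).map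
        (Algebra.TensorProduct.includeLeft (R := R) (S := R) (A := Coord R) (B := Coord R)) ⊔
      (augIdeal R).map
        (Algebra.TensorProduct.includeRight (R := R) (A := Coord R) (B := Coord R))) ^ (m + n) := by
    refine Ideal.pow_right_mono ?_ (m + n) (Ideal.map_pow (comulHom R) (augIdeal R) (m + n) ▸
      Ideal.mem_map_of_mem (comulHom R) hx)
    exact Ideal.map_le_iff_le_comap.mpr fun y hy => comul_aug_mem R hy
  have h2 := Ideal.sup_pow_add_le_pow_sup_pow h1
  rw [← Ideal.map_pow, ← Ideal.map_pow] at h2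
  obtain ⟨u, hu, v, hv, huv⟩ := Submodule.mem_sup.mp h2
  rw [← huv, map_add, map_left_vanish R μ ν _ hμ hu, map_right_vanish R μ ν _ hν hv, add_zero]

/-- The algebra `Dist(SL₂)` of distributions on `SL₂` over `R` supported at the identity: the linear
functionals on the coordinate ring which vanish on some power of the augmentation ideal, with the
convolution product `(μ * ν)(φ) = (μ ⊗ ν)(Δ φ)`. -/
def DistAlg : Subalgebra R (WithConv (Coord R →ₗ[R] R)) where
  carrier := {μ | ∃ n : ℕ, ∀ φ ∈ augIdeal R ^ (n + 1), μ φ = 0}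
  mul_mem' := by
    rintro μ ν ⟨m, hm⟩ ⟨n, hn⟩
    refine ⟨m + 1 + n, fun φ hφ => ?_⟩
    have h := conv_vanish R μ.ofConv ν.ofConv (m + 1) (n + 1) hm hn φ hφ
    rw [LinearMap.convMul_apply]
    exact (congrArg _ h).trans (map_zero _)
  add_mem' := by
    rintro μ ν ⟨m, hm⟩ ⟨n, hn⟩
    refine ⟨m + n, fun φ hφ => ?_⟩
    have h1 := hm φ (Ideal.pow_le_pow_right (by omega) hφ)
    have h2 := hn φ (Ideal.pow_le_pow_right (by omega) hφ)
    rw [WithConv.ofConv_add, LinearMap.add_apply, h1, h2, add_zero]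
  algebraMap_mem' := by
    intro r
    refine ⟨0, fun φ hφ => ?_⟩
    rw [zero_add, pow_one] at hφ
    have h : counitHom R φ = 0 := hφ
    rw [LinearMap.convAlgebraMap_apply]
    have h' : Coalgebra.counit (R := R) φ = 0 := h
    rw [h', map_zero, smul_zero]

/-! ### The divided powers `e⁽ⁿ⁾` and `f⁽ⁿ⁾` -/

open Polynomial in
/-- Functions on `SL₂` restricted to the upper triangular root subgroup `t ↦ !![1, t; 0, 1]`. -/
def restrictUpper : Coord R →ₐ[R] R[X] := evalAt !![1, X; 0, 1] (by simp)

open Polynomial in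
/-- Functions on `SL₂` restricted to the lower triangular root subgroup `t ↦ !![1, 0; t, 1]`. -/
def restrictLower : Coord R →ₐ[R] R[X] := evalAt !![1, 0; X, 1] (by simp)

theorem coeff_vanish (ρ : Coord R →ₐ[R] Polynomial R)
    (hρ : (Polynomial.aeval (0 : R)).comp ρ = counitHom R) (n : ℕ) (φ : Coord R)
    (hφ : φ ∈ augIdeal R ^ (n + 1)) : (ρ φ).coeff n = 0 := by
  have h1 : augIdeal R ≤ (Ideal.span {(Polynomial.X : Polynomial R)}).comap ρ := by
    intro y hy
    have hy0 : counitHom R y = 0 := hy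
    rw [Ideal.mem_comap, Ideal.mem_span_singleton, Polynomial.X_dvd_iff,
      Polynomial.coeff_zero_eq_aeval_zero]
    rw [← hρ, AlgHom.comp_apply] at hy0
    simpa using hy0
  have h2 : ρ φ ∈ Ideal.span {(Polynomial.X : Polynomial R)} ^ (n + 1) := by
    have h3 := Ideal.le_comap_pow ρ (n + 1) (Ideal.pow_right_mono h1 (n + 1) hφ)
    exact h3
  rw [Ideal.span_singleton_pow, Ideal.mem_span_singleton, Polynomial.X_pow_dvd_iff] at h2
  exact h2 n (Nat.lt_succ_self n)

/-- `e⁽ⁿ⁾ = eⁿ/n!` as a distribution: `φ` is sent to the coefficient of `tⁿ` in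
`φ(!![1, t; 0, 1])`. -/
def eDiv (n : ℕ) : DistAlg R :=
  ⟨WithConv.toConv ((Polynomial.lcoeff R n).comp (restrictUpper R).toLinearMap), n, fun φ hφ => by
    refine coeff_vanish R (restrictUpper R) ?_ n φ hφ
    apply coord_hom_ext
    intro i j
    rw [AlgHom.comp_apply, restrictUpper, evalAt_univMatrix, counitHom_univMatrix]
    fin_cases i <;> fin_cases j <;> simp⟩

/-- `f⁽ⁿ⁾ = fⁿ/n!` as a distribution: `φ` is sent to the coefficient of `tⁿ` in
`φ(!![1, 0; t, 1])`. -/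
def fDiv (n : ℕ) : DistAlg R :=
  ⟨WithConv.toConv ((Polynomial.lcoeff R n).comp (restrictLower R).toLinearMap), n, fun φ hφ => by
    refine coeff_vanish R (restrictLower R) ?_ n φ hφ
    apply coord_hom_ext
    intro i j
    rw [AlgHom.comp_apply, restrictLower, evalAt_univMatrix, counitHom_univMatrix]
    fin_cases i <;> fin_cases j <;> simp⟩

end Distributions

/-! ### The abstract algebra given by generators and relations -/

section Presentation

/-- The generating symbols `e^{(p^k)}` and `f^{(p^k)}`, for `k ≥ 0`. -/
inductive Gen : Type
  | e (k : ℕ)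
  | f (k : ℕ)

variable (p : ℕ)

/-- The symbol `e^{(p^k)}` in the free algebra over `𝔽_p`. -/
def symE (k : ℕ) : FreeAlgebra (ZMod p) Gen := FreeAlgebra.ι (ZMod p) (Gen.e k)

/-- The symbol `f^{(p^k)}` in the free algebra over `𝔽_p`. -/
def symF (k : ℕ) : FreeAlgebra (ZMod p) Gen := FreeAlgebra.ι (ZMod p) (Gen.f k)

/-- `X_k = [e^{(p^k)}, f^{(p^k)}]`. -/
def symX (k : ℕ) : FreeAlgebra (ZMod p) Gen := ⁅symE p k, symF p k⁆

/-- The relations 1 to 6, for all `k ≥ 0` and `n > 0`. -/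
inductive Rel : FreeAlgebra (ZMod p) Gen → FreeAlgebra (ZMod p) Gen → Prop
  | rel1e (k : ℕ) : Rel ⁅symX p k, symE p k⁆ (2 * symE p k)
  | rel1f (k : ℕ) : Rel ⁅symX p k, symF p k⁆ (-2 * symF p k)
  | rel2e (k n : ℕ) (hn : 0 < n) : Rel ⁅symX p k, symE p (k + n)⁆ 0
  | rel2f (k n : ℕ) (hn : 0 < n) : Rel ⁅symX p k, symF p (k + n)⁆ 0
  | rel3e (k n : ℕ) (hn : 0 < n) : Rel ⁅symE p k, symE p (k + n)⁆ 0
  | rel3f (k n : ℕ) (hn : 0 < n) : Rel ⁅symF p k, symF p (k + n)⁆ 0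
  | rel4ef (k n : ℕ) (hn : 0 < n) : Rel ⁅symE p k, symF p (k + n)⁆
      ((-1) ^ n * ((List.range n).map fun i => symF p (k + i) ^ (p - 1)).prod * (symX p k + 1))
  | rel4fe (k n : ℕ) (hn : 0 < n) : Rel ⁅symE p (k + n), symF p k⁆
      ((-1) ^ n * (symX p k + 1) * ((List.range n).map fun i => symE p (k + i) ^ (p - 1)).prod)
  | rel5e (k : ℕ) : Rel (symE p k ^ p) 0
  | rel5f (k : ℕ) : Rel (symF p k ^ p) 0
  | rel6 (k : ℕ) : Rel (symX p k ^ p) (symX p k)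

/-- The abstract algebra `H'` over `𝔽_p` with the above generators and relations. -/
abbrev PresentedAlgebra : Type := RingQuot (Rel p)

/-- The evaluation of noncommutative polynomials in the symbols in `H = Dist(SL₂)` over `𝔽_p`. -/
def evalDist : FreeAlgebra (ZMod p) Gen →ₐ[ZMod p] DistAlg (ZMod p) :=
  FreeAlgebra.lift (ZMod p) fun g => match g with
    | Gen.e k => eDiv (ZMod p) (p ^ k)
    | Gen.f k => fDiv (ZMod p) (p ^ k)

/-- The relations 1 to 6 hold in `H = Dist(SL₂)` over `𝔽_p`. -/
def RelationsHold : Prop := ∀ x y, Rel p x y → evalDist p x = evalDist p y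

variable {p} in
/-- The canonical map `H' → H`, available when the relations hold in `H`. -/
def presentationMap (h : RelationsHold p) : PresentedAlgebra p →ₐ[ZMod p] DistAlg (ZMod p) :=
  RingQuot.liftAlgHom (ZMod p) ⟨evalDist p, fun {x y} hxy => h x y hxy⟩

/-- Triples `(a, b, c)` of finitely supported sequences of exponents, all less than `p`. -/
def Exponents : Type :=
  {t : (ℕ →₀ ℕ) × (ℕ →₀ ℕ) × (ℕ →₀ ℕ) // ∀ i, t.1 i < p ∧ t.2.1 i < p ∧ t.2.2 i < p}

/-- The monomial `f^{a₀} ⋯ (f^{(p^n)})^{a_n} X₀^{b₀} ⋯ X_n^{b_n} (e^{(p^n)})^{c_n} ⋯ e^{c₀}` in `H'`,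
where `n` is the largest index in the supports of `a`, `b`, `c`. -/
def pbwMonomial (t : Exponents p) : PresentedAlgebra p :=
  let n := (t.1.1.support ∪ t.1.2.1.support ∪ t.1.2.2.support).sup id
  RingQuot.mkAlgHom (ZMod p) (Rel p)
    (((List.range (n + 1)).map fun i => symF p i ^ t.1.1 i).prod *
      ((List.range (n + 1)).map fun i => symX p i ^ t.1.2.1 i).prod *
      ((List.range (n + 1)).reverse.map fun i => symE p i ^ t.1.2.2 i).prod)

end Presentation

end SL2Dist

end

/-! Three facts are proved: the monomials span H', their images in H are independent, and these
images span H. Bijectivity follows: independence of the images of a spanning family gives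
injectivity, and spanning gives surjectivity.

Spanning of H'. Let H'_r be generated by the e^{(p^k)}, f^{(p^k)} with k < r. Relations 3 and 4 say
that commutators with e^{(p^r)} and f^{(p^r)} map H'_r into itself, while relation 1 makes these two
elements and X_r an sl₂-triple. PBW straightening for the triple, modulo terms of lower degree, then
extends a factorisation H'_r = M T P into f-part, X-part and e-part to the next level
(`triangular_step`, `level_triangular`). Each part is generated by commuting elements with g^p = 0
or g^p = g, so exponents below p suffice.

Independence. The monomials are paired with the functions x₁₀^k x₀₀^i x₀₁^j. Products of divided
powers at powers of p are nonzero multiples of single divided powers f^{(A)} and e^{(C)}, where A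
and C have base p digits a_s and c_s. X_s acts on x₀₀^i by the s-th base p digit of i, by Lucas.
Hence for k ≤ A the pairing vanishes unless k = A and j = C, and is then a nonzero constant times ∏
x_s^{b_s}, where x_s are the digits of i + k + j (`distMonomial_apply`). These digits can be
prescribed at will, and a polynomial over 𝔽_p of degree below p in each variable which vanishes at
all points is zero (`linearIndependent_pbw`).

Spanning of H. Every distribution lives on some Frobenius kernel, that is, it is semilinear over
p^r-th powers of functions. Such distributions form a space of dimension at most p^{3r}
(`finite_frobeniusDist`) containing the p^{3r} independent monomials of level r, which are therefore
a basis of it (`mem_span_pbw`). -/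

noncomputable section

namespace SL2Dist

/-! ### Triangular decompositions of algebras -/

section Triangular

variable {R A : Type*} [CommRing R] [Ring A] [Algebra R A]

/-- The span of `1` and the `sl₂`-triple `f`, `x`, `e`. -/
def tripleSpan (R : Type*) {A : Type*} [CommRing R] [Ring A] [Algebra R A] (e x f : A) :
    Submodule R A := Submodule.span R {1, f, x, e}

/-- The span of the ordered monomials of total degree `n` in `f`, `x`, `e`. -/
def orderedSpan (R : Type*) {A : Type*} [CommRing R] [Ring A] [Algebra R A] (e x f : A) (n : ℕ) :
    Submodule R A := Submodule.span R {w | ∃ a b c, a + b + c = n ∧ w = f ^ a * x ^ b * e ^ c}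

section Triple

variable {e x f : A}

theorem one_mem_tripleSpan : 1 ∈ tripleSpan R e x f := Submodule.subset_span (by simp)

theorem f_mem_tripleSpan : f ∈ tripleSpan R e x f := Submodule.subset_span (by simp)

theorem x_mem_tripleSpan : x ∈ tripleSpan R e x f := Submodule.subset_span (by simp)

theorem e_mem_tripleSpan : e ∈ tripleSpan R e x f := Submodule.subset_span (by simp)

theorem tripleSpan_le {N : Submodule R A} (h1 : 1 ∈ N) (hf : f ∈ N) (hx : x ∈ N) (he : e ∈ N) :
    tripleSpan R e x f ≤ N := by
  rw [tripleSpan, Submodule.span_le]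
  rintro w (rfl | rfl | rfl | rfl) <;> assumption

theorem tripleSpan_pow_le_succ (n : ℕ) :
    tripleSpan R e x f ^ n ≤ tripleSpan R e x f ^ (n + 1) := by
  intro w hw
  rw [pow_succ, ← mul_one w]
  exact Submodule.mul_mem_mul hw one_mem_tripleSpan

theorem ordered_mem_tripleSpan_pow (a b c : ℕ) :
    f ^ a * x ^ b * e ^ c ∈ tripleSpan R e x f ^ (a + b + c) := by
  rw [pow_add, pow_add]
  exact Submodule.mul_mem_mul (Submodule.mul_mem_mul
    (Submodule.pow_mem_pow _ f_mem_tripleSpan a) (Submodule.pow_mem_pow _ x_mem_tripleSpan b))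
    (Submodule.pow_mem_pow _ e_mem_tripleSpan c)

/-- Commutation with `y` as a linear map. -/
def adMap (R : Type*) {A : Type*} [CommRing R] [Ring A] [Algebra R A] (y : A) : A →ₗ[R] A :=
  LinearMap.mulLeft R y - LinearMap.mulRight R y

theorem adMap_apply (y w : A) : adMap R y w = y * w - w * y := rfl

theorem commutator_mem_tripleSpan (hx : x = e * f - f * e) (hxe : x * e - e * x = 2 * e)
    (hxf : x * f - f * x = -2 * f) {g h : A} (hg : g ∈ tripleSpan R e x f)
    (hh : h ∈ tripleSpan R e x f) : g * h - h * g ∈ tripleSpan R e x f := by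
  have key : ∀ g ∈ ({1, f, x, e} : Set A), ∀ h ∈ ({1, f, x, e} : Set A),
      g * h - h * g ∈ tripleSpan R e x f := by
    have h1 := f_mem_tripleSpan (R := R) (e := e) (x := x) (f := f)
    have h2 := e_mem_tripleSpan (R := R) (e := e) (x := x) (f := f)
    have h3 := x_mem_tripleSpan (R := R) (e := e) (x := x) (f := f)
    have hxe' : x * e - e * x ∈ tripleSpan R e x f := by
      rw [hxe, two_mul]; exact add_mem h2 h2
    have hxf' : x * f - f * x ∈ tripleSpan R e x f := by
      rw [hxf, neg_mul, two_mul]; exact neg_mem (add_mem h1 h1)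
    have hef' : e * f - f * e ∈ tripleSpan R e x f := hx ▸ h3
    rintro g (rfl | rfl | rfl | rfl) h (rfl | rfl | rfl | rfl)
    all_goals first
      | assumption
      | (rw [← neg_sub]; exact neg_mem (by assumption))
      | simp
  have step : ∀ g ∈ ({1, f, x, e} : Set A), tripleSpan R e x f ≤
      (tripleSpan R e x f).comap (adMap R g) := fun g hg =>
    Submodule.span_le.mpr fun h hh => key g hg h hh
  have step' : tripleSpan R e x f ≤ (tripleSpan R e x f).comap (adMap R h) :=
    Submodule.span_le.mpr fun g hg => by
      have := step g hg hh
      rw [SetLike.mem_coe, Submodule.mem_comap, adMap_apply, ← neg_sub]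
      exact neg_mem this
  have := step' hg
  rw [Submodule.mem_comap, adMap_apply, ← neg_sub] at this
  simpa using neg_mem this

/-- Commutation with `g` is a derivation preserving the span of the triple and `1`, so it preserves
every power of that span. Reordering factors therefore costs only terms of lower degree. -/
theorem commutator_mem_tripleSpan_pow (hx : x = e * f - f * e) (hxe : x * e - e * x = 2 * e)
    (hxf : x * f - f * x = -2 * f) {g : A} (hg : g ∈ tripleSpan R e x f) (n : ℕ) :
    ∀ w ∈ tripleSpan R e x f ^ n, g * w - w * g ∈ tripleSpan R e x f ^ n := by
  induction n with
  | zero =>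
    intro w hw
    rw [pow_zero, Submodule.mem_one] at hw
    obtain ⟨r, rfl⟩ := hw
    rw [Algebra.commutes, sub_self]
    exact zero_mem _
  | succ n ih =>
    intro w hw
    rw [pow_succ] at hw ⊢
    induction hw using Submodule.mul_induction_on' with
    | mem_mul_mem u hu v hv =>
      have : g * (u * v) - u * v * g = (g * u - u * g) * v + u * (g * v - v * g) := by noncomm_ring
      rw [this]
      exact add_mem (Submodule.mul_mem_mul (ih u hu) hv)
        (Submodule.mul_mem_mul hu (commutator_mem_tripleSpan hx hxe hxf hg hv))
    | add u _ v _ hu hv =>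
      have : g * (u + v) - (u + v) * g = (g * u - u * g) + (g * v - v * g) := by noncomm_ring
      rw [this]
      exact add_mem hu hv

/-- The Poincaré–Birkhoff–Witt straightening for an `sl₂`-triple. -/
theorem tripleSpan_pow_succ_le (hx : x = e * f - f * e) (hxe : x * e - e * x = 2 * e)
    (hxf : x * f - f * x = -2 * f) (n : ℕ) :
    tripleSpan R e x f ^ (n + 1) ≤ orderedSpan R e x f (n + 1) ⊔ tripleSpan R e x f ^ n := by
  induction n with
  | zero =>
    rw [zero_add, pow_one, pow_zero]
    refine tripleSpan_le (Submodule.mem_sup_right (Submodule.mem_one.mpr ⟨1, map_one _⟩))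
      (Submodule.mem_sup_left ?_) (Submodule.mem_sup_left ?_) (Submodule.mem_sup_left ?_)
    · exact Submodule.subset_span ⟨1, 0, 0, rfl, by simp⟩
    · exact Submodule.subset_span ⟨0, 1, 0, rfl, by simp⟩
    · exact Submodule.subset_span ⟨0, 0, 1, rfl, by simp⟩
  | succ n ih =>
    rw [pow_succ' _ (n + 1)]
    refine (mul_le_mul' le_rfl ih).trans ?_
    rw [Submodule.mul_sup, ← pow_succ']
    refine sup_le ?_ le_sup_right
    -- Moving `g` past `u` leaves the error `[g, u] w`, whose degree is one less than that of `g u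
    -- w`. Below, `g` is moved past the letters that must precede it.
    have hcomm : ∀ {g : A}, g ∈ tripleSpan R e x f → ∀ {m : ℕ} {u v w : A},
        u * w = v → u ∈ tripleSpan R e x f ^ m → w ∈ tripleSpan R e x f ^ (n + 1 - m) → m ≤ n + 1 →
        g * v - u * g * w ∈ tripleSpan R e x f ^ (n + 1) := by
      rintro g hg m u _ w rfl hu hw hm
      have : g * (u * w) - u * g * w = (g * u - u * g) * w := by noncomm_ring
      rw [this, ← Nat.add_sub_cancel' hm, pow_add]
      exact Submodule.mul_mem_mul (commutator_mem_tripleSpan_pow hx hxe hxf hg m u hu) hw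
    rw [tripleSpan, orderedSpan, Submodule.span_mul_span, Submodule.span_le]
    rintro _ ⟨g, hg, _, ⟨a, b, c, habc, rfl⟩, rfl⟩
    simp only [SetLike.mem_coe]
    rcases hg with rfl | rfl | rfl | rfl
    · rw [one_mul, ← habc]
      exact Submodule.mem_sup_right (ordered_mem_tripleSpan_pow a b c)
    · refine Submodule.mem_sup_left (Submodule.subset_span ⟨a + 1, b, c, by omega, ?_⟩)
      rw [pow_succ']; noncomm_ring
    · rw [← sub_add_cancel (g * _) (f ^ a * g * (g ^ b * e ^ c))]
      refine add_mem (Submodule.mem_sup_right (hcomm x_mem_tripleSpan (mul_assoc _ _ _).symm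
          (Submodule.pow_mem_pow _ f_mem_tripleSpan a) ?_ (by omega)))
        (Submodule.mem_sup_left (Submodule.subset_span ⟨a, b + 1, c, by omega, ?_⟩))
      · have := ordered_mem_tripleSpan_pow (R := R) (e := e) (x := g) (f := f) 0 b c
        rw [pow_zero, one_mul] at this
        convert this using 2; omega
      · rw [pow_succ']; noncomm_ring
    · rw [← sub_add_cancel (g * _) (f ^ a * x ^ b * g * g ^ c)]
      refine add_mem (Submodule.mem_sup_right (hcomm e_mem_tripleSpan rfl (m := a + b) ?_ ?_
          (by omega))) (Submodule.mem_sup_left (Submodule.subset_span ⟨a, b, c + 1, by omega, ?_⟩))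
      · have := ordered_mem_tripleSpan_pow (R := R) (e := g) (x := x) (f := f) a b 0
        rwa [pow_zero, mul_one] at this
      · convert Submodule.pow_mem_pow _ (e_mem_tripleSpan (R := R) (x := x) (f := f)) c using 2
        omega
      · rw [pow_succ']; noncomm_ring

end Triple

/-- By the Leibniz rule, stability under a commutator needs checking only on generators. -/
theorem commutator_mem_adjoin {g : A} {s : Set A} {S : Subalgebra R A} (hs : s ⊆ S)
    (h : ∀ y ∈ s, g * y - y * g ∈ S) {w : A} (hw : w ∈ Algebra.adjoin R s) :
    g * w - w * g ∈ S := by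
  have hle : Algebra.adjoin R s ≤ S := Algebra.adjoin_le hs
  induction hw using Algebra.adjoin_induction with
  | mem y hy => exact h y hy
  | algebraMap r => rw [Algebra.commutes, sub_self]; exact zero_mem S
  | add u v _ _ hu hv =>
    have : g * (u + v) - (u + v) * g = (g * u - u * g) + (g * v - v * g) := by noncomm_ring
    rw [this]; exact add_mem hu hv
  | mul u v hu' hv' hu hv =>
    have : g * (u * v) - u * v * g = (g * u - u * g) * v + u * (g * v - v * g) := by noncomm_ring
    rw [this]; exact add_mem (mul_mem hu (hle hv')) (mul_mem (hle hu') hv)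

open Subalgebra in
/-- If `S = M T P` is normalised by the `sl₂`-triple `e`, `x`, `f`, where `T` commutes with `f`,
then the algebra generated by `S`, `e`, `f` is `M' T' P'`, where `f`, `x`, `e` have been added
to `M`, `T`, `P`. -/
theorem triangular_step {S M T P M' T' P' : Subalgebra R A} {e x f : A}
    (hx : x = e * f - f * e) (hxe : x * e - e * x = 2 * e) (hxf : x * f - f * x = -2 * f)
    (hS : toSubmodule S ≤ toSubmodule M * toSubmodule T * toSubmodule P)
    (hMS : M ≤ S) (hTS : T ≤ S) (hPS : P ≤ S)
    (hf : ∀ s ∈ S, f * s - s * f ∈ S) (he : ∀ s ∈ S, e * s - s * e ∈ S)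
    (hT : ∀ t ∈ T, Commute t f) (hM' : M ≤ M') (hT' : T ≤ T') (hP' : P ≤ P')
    (hfM : f ∈ M') (hxT : x ∈ T') (heP : e ∈ P') :
    toSubmodule (Algebra.adjoin R (S ∪ {e, f} : Set A)) ≤
      toSubmodule M' * toSubmodule T' * toSubmodule P' := by
  set G := tripleSpan R e x f with hG
  set Q := toSubmodule M' * toSubmodule T' * toSubmodule P' with hQ
  set S₀ := toSubmodule S with hS₀
  have hSS : S₀ * S₀ = S₀ := isIdempotentElem_toSubmodule S
  -- Jacobi identity: since `x = [e, f]`, commutation with `x` is the commutator of the two given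
  -- derivations.
  have hxS : ∀ s ∈ S, x * s - s * x ∈ S := by
    intro s hs
    have : x * s - s * x = (e * (f * s - s * f) - (f * s - s * f) * e) -
        (f * (e * s - s * e) - (e * s - s * e) * f) := by rw [hx]; noncomm_ring
    rw [this]
    exact sub_mem (he _ (hf s hs)) (hf _ (he s hs))
  have hGS : ∀ g ∈ G, ∀ s ∈ S, g * s - s * g ∈ S := by
    intro g hg s hs
    have hle : G ≤ S₀.comap (adMap R s) := tripleSpan_le
      (by simp [adMap_apply])
      (by rw [Submodule.mem_comap, adMap_apply, ← neg_sub]; exact neg_mem (hf s hs))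
      (by rw [Submodule.mem_comap, adMap_apply, ← neg_sub]; exact neg_mem (hxS s hs))
      (by rw [Submodule.mem_comap, adMap_apply, ← neg_sub]; exact neg_mem (he s hs))
    have := hle hg
    rw [Submodule.mem_comap, adMap_apply] at this
    rw [← neg_sub]
    exact S.neg_mem this
  have h1G : (1 : Submodule R A) ≤ G := Submodule.one_le.mpr one_mem_tripleSpan
  have hGS₁ : G * S₀ ≤ S₀ * G := by
    rw [Submodule.mul_le]
    intro g hg s hs
    rw [← sub_add_cancel (g * s) (s * g)]
    refine add_mem ?_ (Submodule.mul_mem_mul hs hg)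
    rw [← mul_one (_ - _)]
    exact Submodule.mul_mem_mul (hGS g hg s hs) one_mem_tripleSpan
  have hGS₂ : ∀ n : ℕ, G ^ n * S₀ ≤ S₀ * G ^ n := by
    intro n
    induction n with
    | zero => simp
    | succ n ih =>
      calc G ^ (n + 1) * S₀ = G ^ n * (G * S₀) := by rw [pow_succ, mul_assoc]
        _ ≤ G ^ n * (S₀ * G) := mul_le_mul' le_rfl hGS₁
        _ = G ^ n * S₀ * G := (mul_assoc _ _ _).symm
        _ ≤ S₀ * G ^ n * G := mul_le_mul' ih le_rfl
        _ = S₀ * G ^ (n + 1) := by rw [pow_succ, mul_assoc]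
  -- Elements of `S` commute with words in the triple modulo words shorter by one letter, with
  -- coefficients in `S` on the left.
  have hcomm : ∀ n : ℕ, ∀ w ∈ G ^ (n + 1), ∀ s ∈ S, w * s - s * w ∈ S₀ * G ^ n := by
    intro n
    induction n with
    | zero =>
      intro w hw s hs
      rw [zero_add, pow_one] at hw
      rw [pow_zero, mul_one]
      exact hGS w hw s hs
    | succ n ih =>
      intro w hw s hs
      rw [pow_succ] at hw
      induction hw using Submodule.mul_induction_on' with
      | mem_mul_mem u hu v hv =>
        have : u * v * s - s * (u * v) = u * (v * s - s * v) + (u * s - s * u) * v := by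
          noncomm_ring
        rw [this]
        refine add_mem (hGS₂ (n + 1) (Submodule.mul_mem_mul hu (hGS v hv s hs))) ?_
        rw [pow_succ, ← mul_assoc]
        exact Submodule.mul_mem_mul (ih u hu s hs) hv
      | add u _ v _ hu hv =>
        have : (u + v) * s - s * (u + v) = (u * s - s * u) + (v * s - s * v) := by noncomm_ring
        rw [this]
        exact add_mem hu hv
  have hSQ : S₀ ≤ Q := hS.trans (mul_le_mul' (mul_le_mul' hM' hT') hP')
  -- Induction on the degree in the triple: the top degree part may be taken ordered by PBW, and all
  -- corrections fall into `S₀ * G ^ n`.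
  have hmain : ∀ n : ℕ, S₀ * G ^ n ≤ Q := by
    intro n
    induction n with
    | zero => simpa using hSQ
    | succ n ih =>
      refine (mul_le_mul' le_rfl (tripleSpan_pow_succ_le hx hxe hxf n)).trans ?_
      rw [Submodule.mul_sup]
      refine sup_le ((mul_le_mul' hS le_rfl).trans ?_) ih
      rw [Submodule.mul_le]
      intro s hs w hw
      induction hw using Submodule.span_induction with
      | zero => simp
      | add u v _ _ hu hv => rw [mul_add]; exact add_mem hu hv
      | smul r u _ hu => rw [mul_smul_comm]; exact Submodule.smul_mem _ r hu
      | mem w hw =>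
      obtain ⟨a, b, c, habc, rfl⟩ := hw
      induction hs using Submodule.mul_induction_on' with
      | add u _ v _ hu hv => rw [add_mul]; exact add_mem hu hv
      | mem_mul_mem q hq z hz =>
      induction hq using Submodule.mul_induction_on' with
      | add u _ v _ hu hv => rw [add_mul, add_mul]; exact add_mem hu hv
      | mem_mul_mem y hy t ht =>
      have hcomm' := hcomm n (f ^ a * x ^ b * e ^ c)
        (habc ▸ ordered_mem_tripleSpan_pow (R := R) a b c) z (hPS hz)
      have htf : t * f ^ a = f ^ a * t := ((hT t ht).pow_right a).eq
      -- Here `z` passes to the far right at the cost of a lower degree term, and `t` passes `f ^ a`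
      -- exactly. This puts each new letter next to the factor `M`, `T` or `P` that it enlarges.
      have : y * t * z * (f ^ a * x ^ b * e ^ c) =
          (y * f ^ a) * (t * x ^ b) * (e ^ c * z) -
          y * t * (f ^ a * x ^ b * e ^ c * z - z * (f ^ a * x ^ b * e ^ c)) := by
        have h2 : (y * f ^ a) * (t * x ^ b) * (e ^ c * z) =
            y * t * (f ^ a * x ^ b * e ^ c * z) := by
          calc _ = y * (f ^ a * t) * x ^ b * e ^ c * z := by noncomm_ring
            _ = _ := by rw [← htf]; noncomm_ring
        rw [h2]; noncomm_ring
      rw [this]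
      refine sub_mem (Submodule.mul_mem_mul (Submodule.mul_mem_mul ?_ ?_) ?_) (ih ?_)
      · exact M'.mul_mem (hM' hy) (pow_mem hfM a)
      · exact T'.mul_mem (hT' ht) (pow_mem hxT b)
      · exact P'.mul_mem (pow_mem heP c) (hP' hz)
      · rw [← hSS, mul_assoc]
        exact Submodule.mul_mem_mul (S.mul_mem (hMS hy) (hTS ht)) hcomm'
  -- The union of the `S₀ * G ^ n` is closed under products, because powers of `G` can be moved to
  -- the right of `S₀`.
  have hgen : ∀ w ∈ Algebra.adjoin R (S ∪ {e, f} : Set A), ∃ n : ℕ, w ∈ S₀ * G ^ n := by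
    have hmono : Monotone fun n : ℕ => S₀ * G ^ n := monotone_nat_of_le_succ fun n =>
      mul_le_mul' le_rfl (tripleSpan_pow_le_succ n)
    have hGmem : ∀ g ∈ G, g ∈ S₀ * G ^ 1 := fun g hg => by
      rw [← one_mul g, pow_one]
      exact Submodule.mul_mem_mul (one_mem S) hg
    intro w hw
    induction hw using Algebra.adjoin_induction with
    | mem y hy =>
      rcases hy with hy | rfl | rfl
      · exact ⟨0, by simpa [hS₀] using hy⟩
      · exact ⟨1, hGmem _ e_mem_tripleSpan⟩
      · exact ⟨1, hGmem _ f_mem_tripleSpan⟩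
    | algebraMap r => exact ⟨0, by simp [hS₀]⟩
    | add u v _ _ hu hv =>
      obtain ⟨m, hm⟩ := hu
      obtain ⟨n, hn⟩ := hv
      exact ⟨max m n, add_mem (hmono (le_max_left m n) hm) (hmono (le_max_right m n) hn)⟩
    | mul u v _ _ hu hv =>
      obtain ⟨m, hm⟩ := hu
      obtain ⟨n, hn⟩ := hv
      refine ⟨m + n, ?_⟩
      have h1 : S₀ * G ^ m * (S₀ * G ^ n) ≤ S₀ * G ^ (m + n) :=
        calc S₀ * G ^ m * (S₀ * G ^ n) = S₀ * (G ^ m * S₀) * G ^ n := by simp only [mul_assoc]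
          _ ≤ S₀ * (S₀ * G ^ m) * G ^ n :=
            mul_le_mul' (mul_le_mul' le_rfl (hGS₂ m)) le_rfl
          _ = S₀ * S₀ * (G ^ m * G ^ n) := by simp only [mul_assoc]
          _ = S₀ * G ^ (m + n) := by rw [hSS, pow_add]
      exact h1 (Submodule.mul_mem_mul hm hn)
  intro w hw
  obtain ⟨n, hn⟩ := hgen w hw
  exact hmain n hn

end Triangular

/-! ### Ordered products of powers -/

section OrderedProducts

/-- The ordered product `g₀ ^ a₀ ⋯ g_{r-1} ^ a_{r-1}`. -/
def orderedProd {A : Type*} [Monoid A] (g : ℕ → A) (a : ℕ → ℕ) (r : ℕ) : A :=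
  ((List.range r).map fun i => g i ^ a i).prod

section Monoid

variable {A : Type*} [Monoid A]

theorem orderedProd_zero (g : ℕ → A) (a : ℕ → ℕ) : orderedProd g a 0 = 1 := rfl

theorem orderedProd_succ (g : ℕ → A) (a : ℕ → ℕ) (r : ℕ) :
    orderedProd g a (r + 1) = orderedProd g a r * g r ^ a r := by
  simp [orderedProd, List.range_succ]

theorem orderedProd_congr (g : ℕ → A) {a b : ℕ → ℕ} {r : ℕ} (h : ∀ i < r, a i = b i) :
    orderedProd g a r = orderedProd g b r := by
  rw [orderedProd, orderedProd]
  congr 1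
  exact List.map_congr_left fun i hi => by rw [h i (List.mem_range.mp hi)]

theorem orderedProd_eq_of_le (g : ℕ → A) {a : ℕ → ℕ} {m r : ℕ} (hmr : m ≤ r)
    (h : ∀ i, m ≤ i → a i = 0) : orderedProd g a r = orderedProd g a m := by
  induction r, hmr using Nat.le_induction with
  | base => rfl
  | succ r hr ih => rw [orderedProd_succ, ih, h r hr, pow_zero, mul_one]

theorem map_orderedProd {B F : Type*} [Monoid B] [FunLike F A B] [MonoidHomClass F A B] (φ : F)
    (g : ℕ → A) (a : ℕ → ℕ) (r : ℕ) :
    φ (orderedProd g a r) = orderedProd (fun i => φ (g i)) a r := by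
  rw [orderedProd, map_list_prod, List.map_map]
  simp [orderedProd, Function.comp_def]

theorem prod_reverse_eq_orderedProd {g : ℕ → A} (hg : ∀ i j, Commute (g i) (g j)) (a : ℕ → ℕ)
    (r : ℕ) : ((List.range r).reverse.map fun i => g i ^ a i).prod = orderedProd g a r := by
  refine List.Perm.prod_eq' ((List.reverse_perm _).map _) ?_
  rw [List.pairwise_map]
  exact List.pairwise_of_forall fun i j => (hg i j).pow_pow _ _

end Monoid

variable {R A : Type*} [CommRing R] [Ring A] [Algebra R A]

/-- The span of the ordered products of the first `r` elements with all exponents below `p`. -/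
def orderedProdSpan (R : Type*) {A : Type*} [CommRing R] [Ring A] [Algebra R A] (g : ℕ → A)
    (p r : ℕ) : Submodule R A :=
  Submodule.span R {w | ∃ a : ℕ → ℕ, (∀ i, a i < p) ∧ w = orderedProd g a r}

theorem orderedProdSpan_mul_mem {g : ℕ → A} (hg : ∀ i j, Commute (g i) (g j)) {p : ℕ}
    (hp : 1 < p) (hpow : ∀ i, g i ^ p = 0 ∨ g i ^ p = g i) {r j : ℕ} (hj : j < r) {w : A}
    (hw : w ∈ orderedProdSpan R g p r) : w * g j ∈ orderedProdSpan R g p r := by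
  induction r generalizing w with
  | zero => omega
  | succ r ih =>
    have hmem : ∀ u ∈ orderedProdSpan R g p r, ∀ m < p,
        u * g r ^ m ∈ orderedProdSpan R g p (r + 1) := by
      intro u hu m hm
      induction hu using Submodule.span_induction with
      | zero => simp
      | add u v _ _ hu hv => rw [add_mul]; exact add_mem hu hv
      | smul c u _ hu => rw [smul_mul_assoc]; exact Submodule.smul_mem _ c hu
      | mem u hu =>
        obtain ⟨a, ha, rfl⟩ := hu
        refine Submodule.subset_span ⟨Function.update a r m, fun i => ?_, ?_⟩
        · rcases eq_or_ne i r with rfl | hi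
          · simpa using hm
          · simpa [hi] using ha i
        · rw [orderedProd_succ, Function.update_self]
          congr 1
          exact orderedProd_congr g fun i hi => by rw [Function.update_of_ne hi.ne]
    induction hw using Submodule.span_induction with
    | zero => simp
    | add u v _ _ hu hv => rw [add_mul]; exact add_mem hu hv
    | smul c u _ hu => rw [smul_mul_assoc]; exact Submodule.smul_mem _ c hu
    | mem u hu =>
      obtain ⟨a, ha, rfl⟩ := hu
      have hbase : orderedProd g a r ∈ orderedProdSpan R g p r :=
        Submodule.subset_span ⟨a, ha, rfl⟩
      rw [orderedProd_succ]
      rcases Nat.lt_succ_iff_lt_or_eq.mp hj with hj | rfl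
      · rw [mul_assoc, ((hg r j).pow_left (a r)).eq, ← mul_assoc]
        exact hmem _ (ih hj hbase) _ (ha r)
      · rw [mul_assoc, ← pow_succ]
        rcases Nat.lt_or_ge (a j + 1) p with h | h
        · exact hmem _ hbase _ h
        -- The exponent has reached `p`: either the product vanishes, or the exponent drops back to
        -- `1 < p`.
        · rw [show a j + 1 = p by have := ha j; omega]
          rcases hpow j with h0 | h1
          · rw [h0, mul_zero]; exact zero_mem _
          · have := hmem _ hbase 1 hp
            rwa [pow_one, ← h1] at this

theorem adjoin_le_orderedProdSpan {g : ℕ → A} (hg : ∀ i j, Commute (g i) (g j)) {p : ℕ}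
    (hp : 1 < p) (hpow : ∀ i, g i ^ p = 0 ∨ g i ^ p = g i) (r : ℕ) :
    Subalgebra.toSubmodule (Algebra.adjoin R (g '' Set.Iio r)) ≤ orderedProdSpan R g p r := by
  intro w hw
  -- Membership is strengthened to stability under right multiplication, a property that passes to
  -- products in the induction over the adjoined algebra.
  have key : ∀ u ∈ orderedProdSpan R g p r, u * w ∈ orderedProdSpan R g p r := by
    replace hw : w ∈ Algebra.adjoin R (g '' Set.Iio r) := hw
    induction hw using Algebra.adjoin_induction with
    | mem y hy =>
      obtain ⟨j, hj, rfl⟩ := hy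
      exact fun u hu => orderedProdSpan_mul_mem hg hp hpow hj hu
    | algebraMap c =>
      intro u hu
      rw [← Algebra.commutes, ← Algebra.smul_def]
      exact Submodule.smul_mem _ c hu
    | add x y _ _ hx hy => intro u hu; rw [mul_add]; exact add_mem (hx u hu) (hy u hu)
    | mul x y _ _ hx hy => intro u hu; rw [← mul_assoc]; exact hy _ (hx u hu)
  have h1 : (1 : A) ∈ orderedProdSpan R g p r :=
    Submodule.subset_span ⟨0, fun _ => by simp; omega, by simp [orderedProd]⟩
  simpa using key 1 h1

end OrderedProducts

/-! ### The monomials span the presented algebra -/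

section Spanning

variable (p : ℕ)

/-- The generator `e^{(p^k)}` of `H'`. -/
def genE (k : ℕ) : PresentedAlgebra p := RingQuot.mkAlgHom (ZMod p) (Rel p) (symE p k)

/-- The generator `f^{(p^k)}` of `H'`. -/
def genF (k : ℕ) : PresentedAlgebra p := RingQuot.mkAlgHom (ZMod p) (Rel p) (symF p k)

/-- The element `X_k = [e^{(p^k)}, f^{(p^k)}]` of `H'`. -/
def genX (k : ℕ) : PresentedAlgebra p := RingQuot.mkAlgHom (ZMod p) (Rel p) (symX p k)

theorem genX_eq (k : ℕ) : genX p k = genE p k * genF p k - genF p k * genE p k := by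
  simp [genX, symX, Ring.lie_def, genE, genF]

theorem genX_commutator_genE (k : ℕ) :
    genX p k * genE p k - genE p k * genX p k = 2 * genE p k := by
  simpa [Ring.lie_def, genX, genE, map_ofNat] using
    RingQuot.mkAlgHom_rel (ZMod p) (Rel.rel1e (p := p) k)

theorem genX_commutator_genF (k : ℕ) :
    genX p k * genF p k - genF p k * genX p k = -2 * genF p k := by
  refine Eq.trans ?_ (neg_mul 2 (genF p k)).symm
  simpa [Ring.lie_def, genX, genF, map_ofNat] using
    RingQuot.mkAlgHom_rel (ZMod p) (Rel.rel1f (p := p) k)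

theorem commute_of_lt_of_commute_self {α : Type*} [Mul α] {g : ℕ → α}
    (h : ∀ k n, 0 < n → Commute (g k) (g (k + n))) (i j : ℕ) : Commute (g i) (g j) := by
  rcases lt_trichotomy i j with hij | rfl | hij
  · simpa [Nat.add_sub_cancel' hij.le] using h i (j - i) (by omega)
  · exact Commute.refl _
  · simpa [Nat.add_sub_cancel' hij.le] using (h j (i - j) (by omega)).symm

theorem commute_genX_genE {k j : ℕ} (h : k < j) : Commute (genX p k) (genE p j) := by
  have := RingQuot.mkAlgHom_rel (ZMod p) (Rel.rel2e (p := p) k (j - k) (by omega))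
  rw [Ring.lie_def, map_sub, map_mul, map_mul, map_zero, sub_eq_zero,
    Nat.add_sub_cancel' h.le] at this
  exact this

theorem commute_genX_genF {k j : ℕ} (h : k < j) : Commute (genX p k) (genF p j) := by
  have := RingQuot.mkAlgHom_rel (ZMod p) (Rel.rel2f (p := p) k (j - k) (by omega))
  rw [Ring.lie_def, map_sub, map_mul, map_mul, map_zero, sub_eq_zero,
    Nat.add_sub_cancel' h.le] at this
  exact this

theorem commute_genE (i j : ℕ) : Commute (genE p i) (genE p j) := by
  refine commute_of_lt_of_commute_self (fun k n hn => ?_) i j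
  have := RingQuot.mkAlgHom_rel (ZMod p) (Rel.rel3e (p := p) k n hn)
  rw [Ring.lie_def, map_sub, map_mul, map_mul, map_zero, sub_eq_zero] at this
  exact this

theorem commute_genF (i j : ℕ) : Commute (genF p i) (genF p j) := by
  refine commute_of_lt_of_commute_self (fun k n hn => ?_) i j
  have := RingQuot.mkAlgHom_rel (ZMod p) (Rel.rel3f (p := p) k n hn)
  rw [Ring.lie_def, map_sub, map_mul, map_mul, map_zero, sub_eq_zero] at this
  exact this

/-- Not itself a relation: by relation 2, X_k commutes with both generators of any higher level,
hence with their commutator. -/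
theorem commute_genX (i j : ℕ) : Commute (genX p i) (genX p j) := by
  refine commute_of_lt_of_commute_self (fun k n hn => ?_) i j
  have h1 := commute_genX_genE p (Nat.lt_add_of_pos_right (n := k) hn)
  have h2 := commute_genX_genF p (Nat.lt_add_of_pos_right (n := k) hn)
  rw [genX_eq p (k + n)]
  exact (h1.mul_right h2).sub_right (h2.mul_right h1)

theorem genE_commutator_genF (k n : ℕ) (hn : 0 < n) :
    genE p k * genF p (k + n) - genF p (k + n) * genE p k =
      (-1) ^ n * ((List.range n).map fun i => genF p (k + i) ^ (p - 1)).prod * (genX p k + 1) := by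
  have := RingQuot.mkAlgHom_rel (ZMod p) (Rel.rel4ef (p := p) k n hn)
  simpa [Ring.lie_def, genX, genF, genE, map_list_prod, Function.comp_def] using this

theorem genE_commutator_genF' (k n : ℕ) (hn : 0 < n) :
    genE p (k + n) * genF p k - genF p k * genE p (k + n) =
      (-1) ^ n * (genX p k + 1) * ((List.range n).map fun i => genE p (k + i) ^ (p - 1)).prod := by
  have := RingQuot.mkAlgHom_rel (ZMod p) (Rel.rel4fe (p := p) k n hn)
  simpa [Ring.lie_def, genX, genF, genE, map_list_prod, Function.comp_def] using this

theorem genE_pow (k : ℕ) : genE p k ^ p = 0 := by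
  simpa [genE] using RingQuot.mkAlgHom_rel (ZMod p) (Rel.rel5e (p := p) k)

theorem genF_pow (k : ℕ) : genF p k ^ p = 0 := by
  simpa [genF] using RingQuot.mkAlgHom_rel (ZMod p) (Rel.rel5f (p := p) k)

theorem genX_pow (k : ℕ) : genX p k ^ p = genX p k := by
  simpa [genX] using RingQuot.mkAlgHom_rel (ZMod p) (Rel.rel6 (p := p) k)

/-- The subalgebra of `H'` generated by `e^{(p^k)}` and `f^{(p^k)}` for `k < r`. -/
def levelSubalgebra (r : ℕ) : Subalgebra (ZMod p) (PresentedAlgebra p) :=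
  Algebra.adjoin (ZMod p) (genE p '' Set.Iio r ∪ genF p '' Set.Iio r)

variable {p}

theorem genE_mem_level {k r : ℕ} (h : k < r) : genE p k ∈ levelSubalgebra p r :=
  Algebra.subset_adjoin (Or.inl ⟨k, h, rfl⟩)

theorem genF_mem_level {k r : ℕ} (h : k < r) : genF p k ∈ levelSubalgebra p r :=
  Algebra.subset_adjoin (Or.inr ⟨k, h, rfl⟩)

theorem genX_mem_level {k r : ℕ} (h : k < r) : genX p k ∈ levelSubalgebra p r := by
  rw [genX_eq]
  exact sub_mem (mul_mem (genE_mem_level h) (genF_mem_level h))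
    (mul_mem (genF_mem_level h) (genE_mem_level h))

theorem level_mono : Monotone (levelSubalgebra p) := fun _ _ h =>
  Algebra.adjoin_mono (Set.union_subset_union (Set.image_mono (Set.Iio_subset_Iio h))
    (Set.image_mono (Set.Iio_subset_Iio h)))

theorem prod_mem_level {g : ℕ → PresentedAlgebra p} {r k : ℕ}
    (hg : ∀ i < r, g i ∈ levelSubalgebra p r) (hk : k < r) (m : ℕ) :
    ((List.range (r - k)).map fun i => g (k + i) ^ m).prod ∈ levelSubalgebra p r := by
  refine list_prod_mem fun w hw => ?_
  obtain ⟨i, hi, rfl⟩ := List.mem_map.mp hw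
  have := List.mem_range.mp hi
  exact pow_mem (hg _ (by omega)) m

/-- On generators of level k < r, relation 4 gives a commutator involving only X_k and the f^{(p^i)}
with k ≤ i < r; relation 3 handles the rest. -/
theorem commutator_genF_mem_level {r : ℕ} {w : PresentedAlgebra p}
    (hw : w ∈ levelSubalgebra p r) :
    genF p r * w - w * genF p r ∈ levelSubalgebra p r := by
  refine commutator_mem_adjoin Algebra.subset_adjoin ?_ hw
  rintro _ (⟨k, hk, rfl⟩ | ⟨k, hk, rfl⟩)
  · have hk' : k < r := hk
    have := genE_commutator_genF p k (r - k) (by omega)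
    rw [Nat.add_sub_cancel' hk'.le] at this
    rw [← neg_sub, this]
    exact neg_mem (mul_mem (mul_mem (pow_mem (neg_mem (one_mem _)) _)
      (prod_mem_level (fun i => genF_mem_level) hk' _))
      (add_mem (genX_mem_level hk') (one_mem _)))
  · rw [(commute_genF p r k).eq, sub_self]
    exact zero_mem _

theorem commutator_genE_mem_level {r : ℕ} {w : PresentedAlgebra p}
    (hw : w ∈ levelSubalgebra p r) :
    genE p r * w - w * genE p r ∈ levelSubalgebra p r := by
  refine commutator_mem_adjoin Algebra.subset_adjoin ?_ hw
  rintro _ (⟨k, hk, rfl⟩ | ⟨k, hk, rfl⟩)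
  · rw [(commute_genE p r k).eq, sub_self]
    exact zero_mem _
  · have hk' : k < r := hk
    have := genE_commutator_genF' p k (r - k) (by omega)
    rw [Nat.add_sub_cancel' hk'.le] at this
    rw [this]
    exact mul_mem (mul_mem (pow_mem (neg_mem (one_mem _)) _)
      (add_mem (genX_mem_level hk') (one_mem _)))
      (prod_mem_level (fun i => genE_mem_level) hk' _)

-- Induction on the level by `triangular_step`. The torus part of lower level commutes with
-- f^{(p^r)} by relation 2.
open Subalgebra in
theorem level_triangular (r : ℕ) : toSubmodule (levelSubalgebra p r) ≤
    toSubmodule (Algebra.adjoin (ZMod p) (genF p '' Set.Iio r)) *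
    toSubmodule (Algebra.adjoin (ZMod p) (genX p '' Set.Iio r)) *
    toSubmodule (Algebra.adjoin (ZMod p) (genE p '' Set.Iio r)) := by
  induction r with
  | zero => simp [levelSubalgebra, Algebra.toSubmodule_bot]
  | succ r ih =>
    have hmono : ∀ g : ℕ → PresentedAlgebra p, Algebra.adjoin (ZMod p) (g '' Set.Iio r) ≤
        Algebra.adjoin (ZMod p) (g '' Set.Iio (r + 1)) := fun g =>
      Algebra.adjoin_mono (Set.image_mono (Set.Iio_subset_Iio r.le_succ))
    have hmem : ∀ g : ℕ → PresentedAlgebra p,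
        g r ∈ Algebra.adjoin (ZMod p) (g '' Set.Iio (r + 1)) := fun g =>
      Algebra.subset_adjoin ⟨r, Nat.lt_succ_self r, rfl⟩
    refine le_trans ?_ (triangular_step (S := levelSubalgebra p r) (genX_eq p r)
      (genX_commutator_genE p r) (genX_commutator_genF p r) ih
      (Algebra.adjoin_mono Set.subset_union_right) (Algebra.adjoin_le ?_)
      (Algebra.adjoin_mono Set.subset_union_left) (fun _ => commutator_genF_mem_level)
      (fun _ => commutator_genE_mem_level) ?_ (hmono _) (hmono _) (hmono _) (hmem _) (hmem _)
      (hmem _))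
    · refine toSubmodule.monotone (Algebra.adjoin_le ?_)
      rintro _ (⟨k, hk, rfl⟩ | ⟨k, hk, rfl⟩)
      · rcases Nat.lt_succ_iff_lt_or_eq.mp hk with hk | rfl
        · exact Algebra.subset_adjoin (Or.inl (genE_mem_level hk))
        · exact Algebra.subset_adjoin (Or.inr (by simp))
      · rcases Nat.lt_succ_iff_lt_or_eq.mp hk with hk | rfl
        · exact Algebra.subset_adjoin (Or.inl (genF_mem_level hk))
        · exact Algebra.subset_adjoin (Or.inr (by simp))
    · rintro _ ⟨k, hk, rfl⟩
      exact genX_mem_level hk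
    · intro t ht
      induction ht using Algebra.adjoin_induction with
      | mem y hy => obtain ⟨k, hk, rfl⟩ := hy; exact commute_genX_genF p hk
      | algebraMap c => exact Algebra.commutes c _
      | add u v _ _ hu hv => exact hu.add_left hv
      | mul u v _ _ hu hv => exact hu.mul_left hv

variable (p) in
theorem exists_mem_level (w : PresentedAlgebra p) : ∃ r, w ∈ levelSubalgebra p r := by
  obtain ⟨w, rfl⟩ := RingQuot.mkAlgHom_surjective (ZMod p) (Rel p) w
  induction w using FreeAlgebra.induction with
  | grade0 c => exact ⟨0, by rw [AlgHom.commutes]; exact algebraMap_mem _ c⟩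
  | grade1 g =>
    cases g with
    | e k => exact ⟨k + 1, genE_mem_level k.lt_succ_self⟩
    | f k => exact ⟨k + 1, genF_mem_level k.lt_succ_self⟩
  | mul u v hu hv =>
    obtain ⟨m, hm⟩ := hu
    obtain ⟨n, hn⟩ := hv
    refine ⟨max m n, ?_⟩
    rw [map_mul]
    exact mul_mem (level_mono (le_max_left m n) hm) (level_mono (le_max_right m n) hn)
  | add u v hu hv =>
    obtain ⟨m, hm⟩ := hu
    obtain ⟨n, hn⟩ := hv
    refine ⟨max m n, ?_⟩
    rw [map_add]
    exact add_mem (level_mono (le_max_left m n) hm) (level_mono (le_max_right m n) hn)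

/-- The exponents vanish from index `r` on. -/
def Exponents.SupportedBelow (t : Exponents p) (r : ℕ) : Prop :=
  ∀ i, r ≤ i → t.1.1 i = 0 ∧ t.1.2.1 i = 0 ∧ t.1.2.2 i = 0

theorem Exponents.SupportedBelow.mono {t : Exponents p} {r s : ℕ} (h : t.SupportedBelow r)
    (hrs : r ≤ s) : t.SupportedBelow s := fun i hi => h i (hrs.trans hi)

theorem Exponents.supportedBelow_sup (t : Exponents p) : t.SupportedBelow
    ((t.1.1.support ∪ t.1.2.1.support ∪ t.1.2.2.support).sup id + 1) := by
  intro i hi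
  by_contra h
  have hmem : i ∈ t.1.1.support ∪ t.1.2.1.support ∪ t.1.2.2.support := by
    simp only [Finset.mem_union, Finsupp.mem_support_iff]
    tauto
  have := Finset.le_sup (f := id) hmem
  simp only [id] at this
  omega

/-- Frees a monomial from its own cutoff index, so that finitely many monomials can share one `r`;
the reversed order of the e-factors is immaterial since they commute. -/
theorem pbwMonomial_eq {t : Exponents p} {r : ℕ} (h : t.SupportedBelow r) :
    pbwMonomial p t = orderedProd (genF p) t.1.1 r * orderedProd (genX p) t.1.2.1 r *
      orderedProd (genE p) t.1.2.2 r := by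
  have h' := t.supportedBelow_sup
  set n := (t.1.1.support ∪ t.1.2.1.support ∪ t.1.2.2.support).sup id with hn
  have key : ∀ (g : ℕ → PresentedAlgebra p) (a : ℕ → ℕ), (∀ i, r ≤ i → a i = 0) →
      (∀ i, n + 1 ≤ i → a i = 0) → orderedProd g a (n + 1) = orderedProd g a r := by
    intro g a h1 h2
    rcases le_total r (n + 1) with hr | hr
    · exact orderedProd_eq_of_le g hr h1
    · exact (orderedProd_eq_of_le g hr h2).symm
  rw [← key _ _ (fun i hi => (h i hi).1) (fun i hi => (h' i hi).1),
    ← key _ _ (fun i hi => (h i hi).2.1) (fun i hi => (h' i hi).2.1),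
    ← key _ _ (fun i hi => (h i hi).2.2) (fun i hi => (h' i hi).2.2),
    ← prod_reverse_eq_orderedProd (commute_genE p)]
  simp only [pbwMonomial, map_mul, map_list_prod, List.map_map, Function.comp_def, map_pow]
  rfl

/-- The triple of exponent sequences with given values below `r` and zero elsewhere. -/
def Exponents.ofFun (r : ℕ) (a b c : ℕ → ℕ) (ha : ∀ i, a i < p) (hb : ∀ i, b i < p)
    (hc : ∀ i, c i < p) : Exponents p :=
  have h : ∀ (a : ℕ → ℕ) i, (if i < r then a i else 0) ≠ 0 → i ∈ Finset.range r := fun a i hi => by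
    by_contra hir
    exact hi (if_neg (by simpa using hir))
  have hlt : ∀ (a : ℕ → ℕ) (_ : ∀ i, a i < p) i, (if i < r then a i else 0) < p := fun a ha i => by
    have := ha i
    split_ifs <;> omega
  ⟨(Finsupp.onFinset (Finset.range r) (fun i => if i < r then a i else 0) (h a),
    Finsupp.onFinset (Finset.range r) (fun i => if i < r then b i else 0) (h b),
    Finsupp.onFinset (Finset.range r) (fun i => if i < r then c i else 0) (h c)),
    fun i => ⟨hlt a ha i, hlt b hb i, hlt c hc i⟩⟩

section OfFun

variable {r : ℕ} {a b c : ℕ → ℕ} {ha : ∀ i, a i < p} {hb : ∀ i, b i < p} {hc : ∀ i, c i < p}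

theorem Exponents.ofFun_fst {i : ℕ} (hi : i < r) :
    (Exponents.ofFun r a b c ha hb hc).1.1 i = a i := if_pos hi

theorem Exponents.ofFun_snd {i : ℕ} (hi : i < r) :
    (Exponents.ofFun r a b c ha hb hc).1.2.1 i = b i := if_pos hi

theorem Exponents.ofFun_trd {i : ℕ} (hi : i < r) :
    (Exponents.ofFun r a b c ha hb hc).1.2.2 i = c i := if_pos hi

theorem Exponents.supportedBelow_ofFun : (Exponents.ofFun r a b c ha hb hc).SupportedBelow r :=
  fun _ hi => ⟨if_neg hi.not_gt, if_neg hi.not_gt, if_neg hi.not_gt⟩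

end OfFun

variable (p) in
theorem span_pbwMonomial [hp : Fact p.Prime] :
    Submodule.span (ZMod p) (Set.range (pbwMonomial p)) = ⊤ := by
  rw [eq_top_iff]
  rintro w -
  obtain ⟨r, hr⟩ := exists_mem_level p w
  have h1 := hp.out.one_lt
  have hw := level_triangular r hr
  have hw' := mul_le_mul' (mul_le_mul'
    (adjoin_le_orderedProdSpan (R := ZMod p) (commute_genF p) h1 (fun i => Or.inl (genF_pow p i)) r)
    (adjoin_le_orderedProdSpan (R := ZMod p) (commute_genX p) h1 (fun i => Or.inr (genX_pow p i)) r))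
    (adjoin_le_orderedProdSpan (R := ZMod p) (commute_genE p) h1 (fun i => Or.inl (genE_pow p i)) r) hw
  rw [orderedProdSpan, orderedProdSpan, orderedProdSpan, Submodule.span_mul_span,
    Submodule.span_mul_span] at hw'
  refine Submodule.span_mono ?_ hw'
  rintro _ ⟨_, ⟨_, ⟨a, ha, rfl⟩, _, ⟨b, hb, rfl⟩, rfl⟩, _, ⟨c, hc, rfl⟩, rfl⟩
  refine ⟨Exponents.ofFun r a b c ha hb hc, ?_⟩
  rw [pbwMonomial_eq Exponents.supportedBelow_ofFun]
  simp only
  rw [orderedProd_congr (genF p) fun i hi => Exponents.ofFun_fst hi,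
    orderedProd_congr (genX p) fun i hi => Exponents.ofFun_snd hi,
    orderedProd_congr (genE p) fun i hi => Exponents.ofFun_trd hi]

end Spanning

/-! ### Translation of functions along one-parameter families -/

section Translation

open Polynomial

variable {R : Type} [CommRing R]

/-- The base change of a polynomial family of matrices to the coordinate ring. -/
def baseChange (M : Matrix (Fin 2) (Fin 2) R[X]) : Matrix (Fin 2) (Fin 2) (Coord R)[X] :=
  M.map (mapAlgHom (Algebra.ofId R (Coord R)))

theorem baseChange_det {M : Matrix (Fin 2) (Fin 2) R[X]} (hM : M.det = 1) :
    (baseChange M).det = 1 := by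
  have := AlgHom.map_det (mapAlgHom (Algebra.ofId R (Coord R))) M
  rw [hM, map_one] at this
  exact this.symm

theorem univMatrix_map_C_det : ((univMatrix R).map (CAlgHom (R := R))).det = 1 := by
  have := AlgHom.map_det (CAlgHom (R := R) (A := Coord R)) (univMatrix R)
  rw [univMatrix_det, map_one] at this
  exact this.symm

/-- Right translation `φ ↦ φ(g M(t))` along the family `M(t)`. -/
def rightTranslate (M : Matrix (Fin 2) (Fin 2) R[X]) (hM : M.det = 1) :
    Coord R →ₐ[R] (Coord R)[X] :=
  evalAt ((univMatrix R).map (CAlgHom (R := R)) * baseChange M)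
    (by rw [Matrix.det_mul, univMatrix_map_C_det, baseChange_det hM, one_mul])

/-- Left translation `φ ↦ φ(M(t) g)` along the family `M(t)`. -/
def leftTranslate (M : Matrix (Fin 2) (Fin 2) R[X]) (hM : M.det = 1) :
    Coord R →ₐ[R] (Coord R)[X] :=
  evalAt (baseChange M * (univMatrix R).map (CAlgHom (R := R)))
    (by rw [Matrix.det_mul, univMatrix_map_C_det, baseChange_det hM, one_mul])

theorem rightTranslate_univMatrix (M : Matrix (Fin 2) (Fin 2) R[X]) (hM : M.det = 1) (i j : Fin 2) :
    rightTranslate M hM (univMatrix R i j) =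
      ∑ k, C (univMatrix R i k) * (M k j).map (algebraMap R (Coord R)) := by
  rw [rightTranslate, evalAt_univMatrix, Matrix.mul_apply]
  rfl

theorem leftTranslate_univMatrix (M : Matrix (Fin 2) (Fin 2) R[X]) (hM : M.det = 1) (i j : Fin 2) :
    leftTranslate M hM (univMatrix R i j) =
      ∑ k, (M i k).map (algebraMap R (Coord R)) * C (univMatrix R k j) := by
  rw [leftTranslate, evalAt_univMatrix, Matrix.mul_apply]
  rfl

/-- Right translation along `M(t)` is comultiplication followed by evaluation of the second factor
at `M(t)`. Convolution with a coefficient distribution thus becomes taking a coefficient of a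
translated function. -/
theorem conv_coeff_right (M : Matrix (Fin 2) (Fin 2) R[X]) (hM : M.det = 1) (n : ℕ)
    (μ : WithConv (Coord R →ₗ[R] R)) (φ : Coord R) :
    (μ * WithConv.toConv ((lcoeff R n).comp (evalAt M hM).toLinearMap)) φ =
      μ ((rightTranslate M hM φ).coeff n) := by
  let Φ : Coord R ⊗[R] Coord R →ₐ[R] (Coord R)[X] :=
    Algebra.TensorProduct.lift (CAlgHom (R := R))
      ((mapAlgHom (Algebra.ofId R (Coord R))).comp (evalAt M hM)) fun _ _ => Commute.all _ _
  have hΦ : rightTranslate M hM = Φ.comp (comulHom R) := by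
    apply coord_hom_ext
    intro i j
    rw [rightTranslate_univMatrix, AlgHom.comp_apply, comulHom_univMatrix, map_sum]
    refine Finset.sum_congr rfl fun k _ => ?_
    rw [Algebra.TensorProduct.lift_tmul, AlgHom.comp_apply, evalAt_univMatrix]
    rfl
  rw [hΦ, AlgHom.comp_apply, LinearMap.convMul_apply]
  change LinearMap.mul' R R (TensorProduct.map _ _ (comulHom R φ)) = _
  induction comulHom R φ with
  | zero => simp
  | add u v hu hv => simp only [map_add, coeff_add, hu, hv]
  | tmul x y =>
    rw [TensorProduct.map_tmul, LinearMap.mul'_apply, Algebra.TensorProduct.lift_tmul]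
    change _ = μ ((C x * (evalAt M hM y).map (algebraMap R (Coord R))).coeff n)
    rw [coeff_C_mul, coeff_map, mul_comm x, ← Algebra.smul_def, map_smul, smul_eq_mul, mul_comm]
    rfl

theorem conv_coeff_left (M : Matrix (Fin 2) (Fin 2) R[X]) (hM : M.det = 1) (n : ℕ)
    (μ : WithConv (Coord R →ₗ[R] R)) (φ : Coord R) :
    (WithConv.toConv ((lcoeff R n).comp (evalAt M hM).toLinearMap) * μ) φ =
      μ ((leftTranslate M hM φ).coeff n) := by
  let Φ : Coord R ⊗[R] Coord R →ₐ[R] (Coord R)[X] :=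
    Algebra.TensorProduct.lift ((mapAlgHom (Algebra.ofId R (Coord R))).comp (evalAt M hM))
      (CAlgHom (R := R)) fun _ _ => Commute.all _ _
  have hΦ : leftTranslate M hM = Φ.comp (comulHom R) := by
    apply coord_hom_ext
    intro i j
    rw [leftTranslate_univMatrix, AlgHom.comp_apply, comulHom_univMatrix, map_sum]
    refine Finset.sum_congr rfl fun k _ => ?_
    rw [Algebra.TensorProduct.lift_tmul, AlgHom.comp_apply, evalAt_univMatrix]
    rfl
  rw [hΦ, AlgHom.comp_apply, LinearMap.convMul_apply]
  change LinearMap.mul' R R (TensorProduct.map _ _ (comulHom R φ)) = _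
  induction comulHom R φ with
  | zero => simp
  | add u v hu hv => simp only [map_add, coeff_add, hu, hv]
  | tmul x y =>
    rw [TensorProduct.map_tmul, LinearMap.mul'_apply, Algebra.TensorProduct.lift_tmul]
    change _ = μ (((evalAt M hM x).map (algebraMap R (Coord R)) * C y).coeff n)
    rw [coeff_mul_C, coeff_map, ← Algebra.smul_def, map_smul, smul_eq_mul]
    rfl

theorem rightTranslate_coeff_zero {M : Matrix (Fin 2) (Fin 2) R[X]} (hM : M.det = 1)
    (h0 : M.map (aeval (0 : R)) = 1) (φ : Coord R) : (rightTranslate M hM φ).coeff 0 = φ := by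
  have key : ((aeval (0 : Coord R)).restrictScalars R).comp (rightTranslate M hM) =
      AlgHom.id R (Coord R) := by
    apply coord_hom_ext
    intro i j
    rw [AlgHom.comp_apply, rightTranslate_univMatrix, map_sum, AlgHom.id_apply]
    have : ∀ k, ((aeval (0 : Coord R)).restrictScalars R)
        (C (univMatrix R i k) * (M k j).map (algebraMap R (Coord R))) =
        univMatrix R i k * algebraMap R (Coord R) ((1 : Matrix (Fin 2) (Fin 2) R) k j) := by
      intro k
      rw [← h0]
      simp [← coeff_zero_eq_aeval_zero, ← coeff_zero_eq_eval_zero]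
    simp [this, Matrix.one_apply, apply_ite (algebraMap R (Coord R))]
  have := DFunLike.congr_fun key φ
  rw [coeff_zero_eq_aeval_zero]
  exact this

/-- The condition `hadd` says M(s)M(t) = M(s+t). The product of the two distributions reads off the
coefficient of s^m t^n in φ(M(s+t)), and the binomial coefficient comes from expanding (s+t)^{m+n}.
-/
theorem coeff_dist_mul {M : Matrix (Fin 2) (Fin 2) R[X]} (hM : M.det = 1)
    (hadd : ∀ i j, ∑ k, C (M i k) * (M k j).map C = taylor X ((M i j).map C)) (m n : ℕ) :
    WithConv.toConv ((lcoeff R m).comp (evalAt M hM).toLinearMap) *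
      WithConv.toConv ((lcoeff R n).comp (evalAt M hM).toLinearMap) =
    ((m + n).choose n : R) •
      WithConv.toConv ((lcoeff R (m + n)).comp (evalAt (R := R) M hM).toLinearMap) := by
  have key : (mapAlgHom (evalAt (R := R) M hM)).comp (rightTranslate M hM) =
      ((taylorAlgHom (X : R[X])).restrictScalars R).comp
        ((mapAlgHom (CAlgHom (R := R) (A := R))).comp (evalAt M hM)) := by
    apply coord_hom_ext
    intro i j
    simp only [AlgHom.comp_apply, rightTranslate_univMatrix, evalAt_univMatrix]
    refine Eq.trans ?_ (hadd i j)
    rw [map_sum]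
    refine Finset.sum_congr rfl fun k _ => ?_
    simp only [map_mul, coe_mapAlgHom, map_C, RingHom.coe_coe,
      evalAt_univMatrix, map_map]
    congr 2
    ext x
    simp
  have hD : ∀ P : R[X], hasseDeriv n (P.map C) = (hasseDeriv n P).map C := fun P => by
    ext1 i
    simp [hasseDeriv_coeff]
  ext φ
  rw [conv_coeff_right]
  have h := congrArg (fun P => (P.coeff n).coeff m) (DFunLike.congr_fun key φ)
  simp only [AlgHom.comp_apply] at h
  change ((map (evalAt (R := R) M hM : Coord R →+* R[X]) _).coeff n).coeff m = ((taylor X (map C (evalAt M hM φ))).coeff n).coeff m at h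
  rw [coeff_map, taylor_coeff, hD, eval_map, eval₂_C_X, hasseDeriv_coeff] at h
  exact h

end Translation

/-! ### Divided powers and their action on monomial functions -/

section DividedPowers

open Polynomial

variable (R : Type) [CommRing R]

theorem eDiv_mul_eDiv (m n : ℕ) :
    eDiv R m * eDiv R n = ((m + n).choose n : R) • eDiv R (m + n) := by
  refine Subtype.ext (coeff_dist_mul _ (fun i j => ?_) m n)
  fin_cases i <;> fin_cases j <;> simp [Fin.sum_univ_two, add_comm]

theorem fDiv_mul_fDiv (m n : ℕ) :
    fDiv R m * fDiv R n = ((m + n).choose n : R) • fDiv R (m + n) := by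
  refine Subtype.ext (coeff_dist_mul _ (fun i j => ?_) m n)
  fin_cases i <;> fin_cases j <;> simp [Fin.sum_univ_two, add_comm]

theorem one_dist_apply (φ : Coord R) : (1 : DistAlg R).1 φ = counitHom R φ := rfl

theorem eDiv_zero : eDiv R 0 = 1 := by
  refine Subtype.ext ?_
  ext φ
  have : (aeval (0 : R)).comp (restrictUpper R) = counitHom R := by
    apply coord_hom_ext
    intro i j
    rw [AlgHom.comp_apply, restrictUpper, evalAt_univMatrix, counitHom_univMatrix]
    fin_cases i <;> fin_cases j <;> simp
  refine Eq.trans ?_ (DFunLike.congr_fun this φ)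
  exact (coeff_zero_eq_aeval_zero _)

theorem fDiv_zero : fDiv R 0 = 1 := by
  refine Subtype.ext ?_
  ext φ
  have : (aeval (0 : R)).comp (restrictLower R) = counitHom R := by
    apply coord_hom_ext
    intro i j
    rw [AlgHom.comp_apply, restrictLower, evalAt_univMatrix, counitHom_univMatrix]
    fin_cases i <;> fin_cases j <;> simp
  refine Eq.trans ?_ (DFunLike.congr_fun this φ)
  exact (coeff_zero_eq_aeval_zero _)

variable {R}

theorem coeff_C_mul_X_add_C_pow (u v : R) (j n : ℕ) :
    ((C u * X + C v) ^ j).coeff n = (j.choose n : R) * (u ^ n * v ^ (j - n)) := by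
  rw [add_pow, finsetSum_coeff]
  have : ∀ m, ((C u * X) ^ m * C v ^ (j - m) * (j.choose m : R[X])).coeff n =
      if n = m then (j.choose m : R) * (u ^ m * v ^ (j - m)) else 0 := by
    intro m
    rw [show (C u * X) ^ m * C v ^ (j - m) * (j.choose m : R[X]) =
      C ((j.choose m : R) * (u ^ m * v ^ (j - m))) * X ^ m by
        simp only [map_mul, map_pow, map_natCast, mul_pow]; ring, coeff_C_mul_X_pow]
  simp only [this, Finset.sum_ite_eq, Finset.mem_range]
  split_ifs with hn
  · rfl
  · rw [Nat.choose_eq_zero_of_lt (by omega), Nat.cast_zero, zero_mul]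

/-- The function `x₀₀ ^ i * x₀₁ ^ j` on `SL₂`. -/
def rowMonomial (R : Type) [CommRing R] (i j : ℕ) : Coord R :=
  univMatrix R 0 0 ^ i * univMatrix R 0 1 ^ j

theorem natCast_mul_apply (μ : WithConv (Coord R →ₗ[R] R)) (n : ℕ) (φ : Coord R) :
    μ ((n : Coord R) * φ) = n * μ φ := by
  rw [← nsmul_eq_mul, ← nsmul_eq_mul]
  exact map_nsmul μ.ofConv n φ

/-- Right translation by the upper root subgroup fixes x₀₀ and sends x₀₁ to x₀₁ + t x₀₀, so it stays
within functions of the first row. -/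
theorem mul_eDiv_apply (μ : DistAlg R) (n i j : ℕ) : (μ * eDiv R n).1 (rowMonomial R i j) =
    j.choose n * μ.1 (rowMonomial R (i + n) (j - n)) := by
  refine (conv_coeff_right _ _ n μ.1 _).trans ?_
  have h0 : rightTranslate !![1, X; 0, 1] (by simp) (univMatrix R 0 0) = C (univMatrix R 0 0) := by
    simp [rightTranslate_univMatrix, Fin.sum_univ_two]
  have h1 : rightTranslate !![1, X; 0, 1] (by simp) (univMatrix R 0 1) =
      C (univMatrix R 0 0) * X + C (univMatrix R 0 1) := by
    simp [rightTranslate_univMatrix, Fin.sum_univ_two]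
  rw [rowMonomial, map_mul, map_pow, map_pow, h0, h1, ← C_pow, coeff_C_mul,
    coeff_C_mul_X_add_C_pow, mul_left_comm, natCast_mul_apply, rowMonomial, ← mul_assoc, ← pow_add]

theorem mul_fDiv_apply (μ : DistAlg R) (n i j : ℕ) : (μ * fDiv R n).1 (rowMonomial R i j) =
    i.choose n * μ.1 (rowMonomial R (i - n) (j + n)) := by
  refine (conv_coeff_right _ _ n μ.1 _).trans ?_
  have h0 : rightTranslate !![1, 0; X, 1] (by simp) (univMatrix R 0 0) =
      C (univMatrix R 0 1) * X + C (univMatrix R 0 0) := by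
    simp [rightTranslate_univMatrix, Fin.sum_univ_two, add_comm]
  have h1 : rightTranslate !![1, 0; X, 1] (by simp) (univMatrix R 0 1) = C (univMatrix R 0 1) := by
    simp [rightTranslate_univMatrix, Fin.sum_univ_two]
  rw [rowMonomial, map_mul, map_pow, map_pow, h0, h1, ← C_pow, coeff_mul_C,
    coeff_C_mul_X_add_C_pow, mul_assoc, natCast_mul_apply, rowMonomial]
  congr 2
  ring

/-- Left translation by the lower root subgroup fixes the first row and sends x₁₀ to x₁₀ + t x₀₀.
The exponent of x₁₀ thus detects the f-part of a monomial. -/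
theorem fDiv_mul_apply (μ : DistAlg R) (n k i j : ℕ) :
    (fDiv R n * μ).1 (univMatrix R 1 0 ^ k * rowMonomial R i j) =
      k.choose n * μ.1 (univMatrix R 1 0 ^ (k - n) * rowMonomial R (i + n) j) := by
  refine (conv_coeff_left _ _ n μ.1 _).trans ?_
  have h0 : leftTranslate !![1, 0; X, 1] (by simp) (univMatrix R 0 0) = C (univMatrix R 0 0) := by
    simp [leftTranslate_univMatrix, Fin.sum_univ_two]
  have h1 : leftTranslate !![1, 0; X, 1] (by simp) (univMatrix R 0 1) = C (univMatrix R 0 1) := by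
    simp [leftTranslate_univMatrix, Fin.sum_univ_two]
  have h2 : leftTranslate !![1, 0; X, 1] (by simp) (univMatrix R 1 0) =
      C (univMatrix R 0 0) * X + C (univMatrix R 1 0) := by
    simp [leftTranslate_univMatrix, Fin.sum_univ_two, X_mul_C]
  rw [rowMonomial, map_mul, map_mul, map_pow, map_pow, map_pow, h0, h1, h2, ← C_pow, ← C_pow,
    ← C_mul, coeff_mul_C, coeff_C_mul_X_add_C_pow, mul_assoc, natCast_mul_apply, rowMonomial]
  congr 2
  ring

/-- The distribution `[e⁽ⁿ⁾, f⁽ⁿ⁾]`. -/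
def xDist (R : Type) [CommRing R] (n : ℕ) : DistAlg R :=
  eDiv R n * fDiv R n - fDiv R n * eDiv R n

/-- e^{(n)} and f^{(n)} shift the exponents (i, j) in opposite directions, so row monomials are
eigenvectors of their commutator. -/
theorem mul_xDist_apply (μ : DistAlg R) (n i j : ℕ) : (μ * xDist R n).1 (rowMonomial R i j) =
    ((i.choose n : R) * (j + n).choose n - j.choose n * (i + n).choose n) *
      μ.1 (rowMonomial R i j) := by
  have hsub : (μ * xDist R n).1 (rowMonomial R i j) =
      (μ * eDiv R n * fDiv R n).1 (rowMonomial R i j) -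
      (μ * fDiv R n * eDiv R n).1 (rowMonomial R i j) := by
    have : μ * xDist R n = μ * eDiv R n * fDiv R n - μ * fDiv R n * eDiv R n := by
      rw [mul_assoc, mul_assoc]
      exact mul_sub μ (eDiv R n * fDiv R n) (fDiv R n * eDiv R n)
    rw [this]
    rfl
  rw [hsub, mul_fDiv_apply, mul_eDiv_apply, mul_eDiv_apply, mul_fDiv_apply, Nat.add_sub_cancel,
    Nat.add_sub_cancel, sub_mul]
  congr 1
  · rcases Nat.lt_or_ge i n with h | h
    · simp [Nat.choose_eq_zero_of_lt h]
    · rw [Nat.sub_add_cancel h, mul_assoc]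
  · rcases Nat.lt_or_ge j n with h | h
    · simp [Nat.choose_eq_zero_of_lt h]
    · rw [Nat.sub_add_cancel h, mul_assoc]

end DividedPowers

/-! ### Base `p` expansions -/

section Digits

/-- The number `∑_{i<r} a_i p^i`. -/
def digitSum (p : ℕ) (a : ℕ → ℕ) (r : ℕ) : ℕ := ∑ i ∈ Finset.range r, a i * p ^ i

variable {p : ℕ}

theorem digitSum_succ (a : ℕ → ℕ) (r : ℕ) :
    digitSum p a (r + 1) = digitSum p a r + a r * p ^ r := Finset.sum_range_succ _ _

theorem digitSum_lt {a : ℕ → ℕ} (ha : ∀ i, a i < p) (r : ℕ) : digitSum p a r < p ^ r := by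
  induction r with
  | zero => simp [digitSum]
  | succ r ih =>
    rw [digitSum_succ, pow_succ]
    have : (a r + 1) * p ^ r ≤ p * p ^ r := Nat.mul_le_mul_right _ (ha r)
    rw [mul_comm (p ^ r)]
    linarith [add_mul (a r) 1 (p ^ r)]

theorem digitSum_div_mod {a : ℕ → ℕ} (ha : ∀ i, a i < p) {r s : ℕ} (hs : s < r) (m : ℕ) :
    (digitSum p a r + p ^ r * m) / p ^ s % p = a s := by
  have hp : 0 < p := (Nat.zero_le _).trans_lt (ha 0)
  induction r generalizing m with
  | zero => omega
  | succ r ih =>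
    -- The leading digit is absorbed into the multiple of `p ^ r`; hence the free parameter `m` in
    -- the induction.
    have hre : digitSum p a (r + 1) + p ^ (r + 1) * m = digitSum p a r + p ^ r * (a r + p * m) := by
      rw [digitSum_succ, pow_succ]; ring
    rw [hre]
    rcases Nat.lt_succ_iff_lt_or_eq.mp hs with h | rfl
    · exact ih h _
    · rw [Nat.add_mul_div_left _ _ (pow_pos hp s), Nat.div_eq_of_lt (digitSum_lt ha s), zero_add,
        Nat.add_mul_mod_self_left, Nat.mod_eq_of_lt (ha s)]

theorem eq_of_digitSum_eq {a b : ℕ → ℕ} (ha : ∀ i, a i < p) (hb : ∀ i, b i < p) {r : ℕ}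
    (h : digitSum p a r = digitSum p b r) {s : ℕ} (hs : s < r) : a s = b s := by
  rw [← digitSum_div_mod ha hs 0, ← digitSum_div_mod hb hs 0, h]

variable [hp : Fact p.Prime]

/-- Lucas's theorem, one digit at a time. Modulo `p` the right side is the `s`-th base `p` digit of
`N`. -/
theorem choose_prime_pow_cast (N s : ℕ) :
    ((N.choose (p ^ s) : ℕ) : ZMod p) = ((N / p ^ s : ℕ) : ZMod p) := by
  induction s generalizing N with
  | zero => simp
  | succ s ih =>
    have h := Choose.choose_modEq_choose_mod_mul_choose_div_nat (p := p) (n := N) (k := p ^ (s + 1))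
    rw [pow_succ', Nat.mul_mod_right, Nat.mul_div_cancel_left _ hp.out.pos, Nat.choose_zero_right,
      one_mul, ← ZMod.natCast_eq_natCast_iff, ih] at h
    rw [pow_succ', h, Nat.div_div_eq_div_mul]

/-- Ordered products of divided powers `g⁽ⁿ⁾` with `n` a power of `p` are divided powers, up to
units. -/
theorem orderedProd_dividedPowers {D : Type*} [Semiring D] [Algebra (ZMod p) D] {g : ℕ → D}
    (h0 : g 0 = 1) (hmul : ∀ m n, g m * g n = ((m + n).choose n : ZMod p) • g (m + n))
    {a : ℕ → ℕ} (ha : ∀ i, a i < p) (r : ℕ) :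
    ∃ u : ZMod p, u ≠ 0 ∧ orderedProd (fun k => g (p ^ k)) a r = u • g (digitSum p a r) := by
  induction r with
  | zero => exact ⟨1, one_ne_zero, by simp [orderedProd_zero, digitSum, h0]⟩
  | succ r ih =>
    obtain ⟨u, hu, ih⟩ := ih
    have key : ∀ m < p, ∃ v : ZMod p, v ≠ 0 ∧ g (digitSum p a r) * g (p ^ r) ^ m =
        v • g (digitSum p a r + m * p ^ r) := by
      intro m
      induction m with
      | zero => exact fun _ => ⟨1, one_ne_zero, by simp⟩
      | succ m ihm =>
        intro hm
        obtain ⟨v, hv, ihm⟩ := ihm (by omega)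
        -- The binomial coefficient produced by one more factor is `m + 1` modulo `p`, nonzero
        -- because `m + 1 < p`.
        have hA : (digitSum p a r + m * p ^ r + p ^ r) / p ^ r = m + 1 := by
          rw [add_assoc, ← Nat.succ_mul, Nat.add_mul_div_right _ _ (pow_pos hp.out.pos r),
            Nat.div_eq_of_lt (digitSum_lt ha r), zero_add]
        refine ⟨v * ((m + 1 : ℕ) : ZMod p), mul_ne_zero hv ?_, ?_⟩
        · rw [Ne, ZMod.natCast_eq_zero_iff]
          exact fun h => absurd (Nat.le_of_dvd m.succ_pos h) (by omega)
        · rw [pow_succ, ← mul_assoc, ihm, smul_mul_assoc, hmul, choose_prime_pow_cast, hA,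
            smul_smul, add_assoc, ← Nat.succ_mul]
    obtain ⟨v, hv, key⟩ := key (a r) (ha r)
    exact ⟨u * v, mul_ne_zero hu hv, by
      rw [orderedProd_succ, ih, smul_mul_assoc, key, smul_smul, digitSum_succ]⟩

end Digits

/-! ### Pairing monomials with functions -/

section Pairing

variable {p : ℕ} [hp : Fact p.Prime]

theorem counit_rowMonomial (R : Type) [CommRing R] (i j : ℕ) :
    counitHom R (rowMonomial R i j) = if j = 0 then 1 else 0 := by
  rw [rowMonomial, map_mul, map_pow, map_pow, counitHom_univMatrix, counitHom_univMatrix]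
  simp [zero_pow_eq]

/-- Only the eigenvalues at `j = 0` are made explicit: the counit, to which this is later applied,
kills every row monomial with `j ≠ 0`. -/
theorem orderedProd_xDist_apply (b : ℕ → ℕ) (r : ℕ) : ∃ l : ℕ → ℕ → ZMod p,
    (∀ i, l i 0 = ∏ s ∈ Finset.range r, ((i / p ^ s : ℕ) : ZMod p) ^ b s) ∧
    ∀ (μ : DistAlg (ZMod p)) (i j : ℕ),
      (μ * orderedProd (fun k => xDist (ZMod p) (p ^ k)) b r).1 (rowMonomial (ZMod p) i j) =
        l i j * μ.1 (rowMonomial (ZMod p) i j) := by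
  induction r with
  | zero => exact ⟨fun _ _ => 1, by simp, fun μ i j => by rw [orderedProd_zero, mul_one, one_mul]⟩
  | succ r ih =>
    obtain ⟨l, hl, ih⟩ := ih
    let c : ℕ → ℕ → ZMod p := fun i j =>
      (i.choose (p ^ r) : ZMod p) * (j + p ^ r).choose (p ^ r) -
        j.choose (p ^ r) * (i + p ^ r).choose (p ^ r)
    have hpow : ∀ (m : ℕ) (μ : DistAlg (ZMod p)) (i j : ℕ),
        (μ * xDist (ZMod p) (p ^ r) ^ m).1 (rowMonomial (ZMod p) i j) =
          c i j ^ m * μ.1 (rowMonomial (ZMod p) i j) := by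
      intro m
      induction m with
      | zero => intro μ i j; rw [pow_zero, mul_one, pow_zero, one_mul]
      | succ m ihm =>
        intro μ i j
        rw [pow_succ, ← mul_assoc, mul_xDist_apply, ihm, pow_succ', mul_assoc]
    refine ⟨fun i j => c i j ^ b r * l i j, fun i => ?_, fun μ i j => ?_⟩
    · have : c i 0 = ((i / p ^ r : ℕ) : ZMod p) := by
        simp only [c]
        rw [choose_prime_pow_cast, Nat.choose_eq_zero_of_lt (pow_pos hp.out.pos r), zero_add,
          Nat.choose_self]
        simp
      simp only [hl, this, Finset.prod_range_succ, mul_comm]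
    · rw [orderedProd_succ, ← mul_assoc, hpow, ih, mul_assoc]

/-- The monomial `∏ (f^{(p^i)})^{a_i} ∏ X_i^{b_i} ∏ (e^{(p^i)})^{c_i}` in `H`. -/
def distMonomial (p r : ℕ) (a b c : ℕ → ℕ) : DistAlg (ZMod p) :=
  orderedProd (fun k => fDiv (ZMod p) (p ^ k)) a r *
    orderedProd (fun k => xDist (ZMod p) (p ^ k)) b r *
    orderedProd (fun k => eDiv (ZMod p) (p ^ k)) c r

/-- For `k` below the f-degree the binomial coefficient from `fDiv_mul_apply` vanishes. At equality
x₁₀ disappears, the e-part kills `j` too small, and the counit kills `j` too large. Nothing is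
claimed for larger `k`. -/
theorem distMonomial_apply (r : ℕ) {a b c : ℕ → ℕ} (ha : ∀ i, a i < p) (hc : ∀ i, c i < p) :
    ∃ u : ZMod p, u ≠ 0 ∧ ∀ k i j, k ≤ digitSum p a r →
      (distMonomial p r a b c).1 (univMatrix (ZMod p) 1 0 ^ k * rowMonomial (ZMod p) i j) =
        if k = digitSum p a r ∧ j = digitSum p c r then
          u * ∏ s ∈ Finset.range r, (((i + k + j) / p ^ s : ℕ) : ZMod p) ^ b s
        else 0 := by
  obtain ⟨u, hu, hF⟩ := orderedProd_dividedPowers (fDiv_zero (ZMod p)) (fDiv_mul_fDiv (ZMod p)) ha r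
  obtain ⟨v, hv, hE⟩ := orderedProd_dividedPowers (eDiv_zero (ZMod p)) (eDiv_mul_eDiv (ZMod p)) hc r
  obtain ⟨l, hl, hX⟩ := orderedProd_xDist_apply (p := p) b r
  refine ⟨u * v, mul_ne_zero hu hv, fun k i j hk => ?_⟩
  rw [distMonomial, hF, hE]
  set X := orderedProd (fun k => xDist (ZMod p) (p ^ k)) b r with hXdef
  set A := digitSum p a r
  set C := digitSum p c r
  have hscal : (u • fDiv (ZMod p) A * X * v • eDiv (ZMod p) C).1
      (univMatrix (ZMod p) 1 0 ^ k * rowMonomial (ZMod p) i j) =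
      u * v * (fDiv (ZMod p) A * (X * eDiv (ZMod p) C)).1
        (univMatrix (ZMod p) 1 0 ^ k * rowMonomial (ZMod p) i j) := by
    rw [mul_smul_comm, smul_mul_assoc, smul_mul_assoc, smul_smul, mul_comm v u, ← mul_assoc]
    rfl
  rw [hscal, fDiv_mul_apply]
  rcases hk.lt_or_eq with hk | hk
  · rw [Nat.choose_eq_zero_of_lt hk, if_neg (fun h => hk.ne h.1)]
    simp
  rw [hk, Nat.choose_self, Nat.sub_self, pow_zero, one_mul, mul_eDiv_apply]
  have hX1 := hX 1 (i + A + C) (j - C)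
  rw [one_mul, one_dist_apply, counit_rowMonomial] at hX1
  rw [hX1]
  rcases lt_trichotomy j C with h | h | h
  · rw [Nat.choose_eq_zero_of_lt h, if_neg (c := A = A ∧ j = C) (fun h' => h.ne h'.2)]
    simp
  · rw [if_pos (by omega), if_pos ⟨rfl, h⟩, h, Nat.sub_self, hl, Nat.choose_self]
    simp
  · rw [if_neg (by omega), if_neg (fun h' => h.ne' h'.2)]
    simp

end Pairing

/-! ### Linear independence -/

section Independence

variable {p : ℕ}

theorem exists_supportedBelow (s : Finset (Exponents p)) : ∃ r, ∀ t ∈ s, t.SupportedBelow r :=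
  ⟨s.sup fun t => (t.1.1.support ∪ t.1.2.1.support ∪ t.1.2.2.support).sup id + 1, fun t ht =>
    t.supportedBelow_sup.mono (Finset.le_sup (f := fun t : Exponents p =>
      (t.1.1.support ∪ t.1.2.1.support ∪ t.1.2.2.support).sup id + 1) ht)⟩

theorem Exponents.eq_of_digitSum_eq {t t' : Exponents p} {r : ℕ} (h : t.SupportedBelow r)
    (h' : t'.SupportedBelow r) (ha : digitSum p t.1.1 r = digitSum p t'.1.1 r)
    (hb : ∀ i < r, t.1.2.1 i = t'.1.2.1 i)
    (hc : digitSum p t.1.2.2 r = digitSum p t'.1.2.2 r) : t = t' := by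
  refine Subtype.ext (Prod.ext (Finsupp.ext fun i => ?_)
    (Prod.ext (Finsupp.ext fun i => ?_) (Finsupp.ext fun i => ?_)))
  all_goals rcases Nat.lt_or_ge i r with hi | hi
  · exact SL2Dist.eq_of_digitSum_eq (fun i => (t.2 i).1) (fun i => (t'.2 i).1) ha hi
  · rw [(h i hi).1, (h' i hi).1]
  · exact hb i hi
  · rw [(h i hi).2.1, (h' i hi).2.1]
  · exact SL2Dist.eq_of_digitSum_eq (fun i => (t.2 i).2.2) (fun i => (t'.2 i).2.2) hc hi
  · rw [(h i hi).2.2, (h' i hi).2.2]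

variable [hp : Fact p.Prime]

theorem evalDist_symX (k : ℕ) : evalDist p (symX p k) = xDist (ZMod p) (p ^ k) := by
  rw [symX, Ring.lie_def, map_sub, map_mul, map_mul, xDist]
  simp only [symE, symF, evalDist, FreeAlgebra.lift_ι_apply]

theorem presentationMap_pbwMonomial (hrel : RelationsHold p) {t : Exponents p} {r : ℕ}
    (h : t.SupportedBelow r) : presentationMap hrel (pbwMonomial p t) =
      distMonomial p r t.1.1 t.1.2.1 t.1.2.2 := by
  have hF : ∀ k, presentationMap hrel (genF p k) = fDiv (ZMod p) (p ^ k) := fun k => by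
    rw [presentationMap, genF, RingQuot.liftAlgHom_mkAlgHom_apply, symF, evalDist,
      FreeAlgebra.lift_ι_apply]
  have hE : ∀ k, presentationMap hrel (genE p k) = eDiv (ZMod p) (p ^ k) := fun k => by
    rw [presentationMap, genE, RingQuot.liftAlgHom_mkAlgHom_apply, symE, evalDist,
      FreeAlgebra.lift_ι_apply]
  have hX : ∀ k, presentationMap hrel (genX p k) = xDist (ZMod p) (p ^ k) := fun k => by
    rw [presentationMap, genX, RingQuot.liftAlgHom_mkAlgHom_apply, evalDist_symX]
  rw [pbwMonomial_eq h, map_mul, map_mul, map_orderedProd, map_orderedProd, map_orderedProd]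
  simp only [hF, hE, hX, distMonomial]

theorem exists_digits (r m : ℕ) (x : Fin r → ZMod p) :
    ∃ i, ∀ s : Fin r, (((i + m) / p ^ (s : ℕ) : ℕ) : ZMod p) = x s := by
  let a : ℕ → ℕ := fun s => if h : s < r then (x ⟨s, h⟩).val else 0
  have ha : ∀ i, a i < p := fun i => by
    simp only [a]
    split_ifs
    · exact ZMod.val_lt _
    · exact hp.out.pos
  have hm : m ≤ p ^ r * m := Nat.le_mul_of_pos_left m (pow_pos hp.out.pos r)
  -- Adding `p ^ r * m` leaves the lower `r` digits alone and makes the subtraction of `m` exact.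
  refine ⟨digitSum p a r + p ^ r * m - m, fun s => ?_⟩
  rw [Nat.sub_add_cancel (by omega), ← ZMod.natCast_mod, digitSum_div_mod ha s.2]
  simp [a]

theorem linearIndependent_pbw (hrel : RelationsHold p) : LinearIndependent (ZMod p)
    fun t : Exponents p => presentationMap hrel (pbwMonomial p t) := by
  classical
  rw [linearIndependent_iff']
  intro S g hsum
  by_contra! hne
  obtain ⟨r, hr⟩ := exists_supportedBelow S
  -- Minimal f-degree is needed because the pairing is known only for test exponents `k` not
  -- exceeding the f-degree.
  obtain ⟨t₀, ht₀, hg₀, hmin⟩ : ∃ t₀ ∈ S, g t₀ ≠ 0 ∧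
      ∀ t ∈ S, g t ≠ 0 → digitSum p t₀.1.1 r ≤ digitSum p t.1.1 r := by
    obtain ⟨t₁, ht₁, hg₁⟩ := hne
    obtain ⟨t₀, h, hmin⟩ := (S.filter (g · ≠ 0)).exists_min_image
      (fun t => digitSum p t.1.1 r) ⟨t₁, by simp [ht₁, hg₁]⟩
    rw [Finset.mem_filter] at h
    exact ⟨t₀, h.1, h.2, fun t ht hgt => hmin t (by simp [ht, hgt])⟩
  set A := digitSum p t₀.1.1 r
  set C := digitSum p t₀.1.2.2 r
  choose u hu hpair using fun t : Exponents p =>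
    distMonomial_apply r (b := t.1.2.1) (fun i => (t.2 i).1) (fun i => (t.2 i).2.2)
  let b : Exponents p → Fin r →₀ ℕ := fun t => Finsupp.equivFunOnFinite.symm fun s => t.1.2.1 s
  let S' := S.filter fun t => digitSum p t.1.1 r = A ∧ digitSum p t.1.2.2 r = C
  -- `S'` collects the terms surviving the test with `k = A` and `j = C`; as `i` varies, the tests
  -- evaluate `P` at every point of 𝔽_p^r.
  let P : MvPolynomial (Fin r) (ZMod p) := ∑ t ∈ S', MvPolynomial.monomial (b t) (g t * u t)
  have hP : P = 0 := by
    refine MvPolynomial.eq_zero_of_eval_eq_zero _ _ P (fun x => ?_) ?_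
    · obtain ⟨i, hi⟩ := exists_digits r (A + C) x
      have h0 : ∑ t ∈ S, g t * (presentationMap hrel (pbwMonomial p t)).1
          (univMatrix (ZMod p) 1 0 ^ A * rowMonomial (ZMod p) i C) = 0 := by
        let ev : DistAlg (ZMod p) →ₗ[ZMod p] ZMod p :=
          { toFun := fun μ => μ.1 (univMatrix (ZMod p) 1 0 ^ A * rowMonomial (ZMod p) i C)
            map_add' := fun _ _ => rfl
            map_smul' := fun _ _ => rfl }
        have := congrArg ev hsum
        rw [map_sum, map_zero] at this
        exact this
      rw [← h0, map_sum, Finset.sum_filter]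
      refine Finset.sum_congr rfl fun t ht => ?_
      rcases eq_or_ne (g t) 0 with hgt | hgt
      · simp [hgt]
      rw [presentationMap_pbwMonomial hrel (hr t ht), hpair t A i C (hmin t ht hgt)]
      simp only [eq_comm (a := A), eq_comm (a := C)]
      split_ifs
      · rw [MvPolynomial.eval_monomial, Finsupp.prod_fintype _ _ (fun _ => pow_zero _), mul_assoc,
          Finset.prod_range]
        congr 2
        refine Finset.prod_congr rfl fun s _ => ?_
        rw [add_assoc, hi s]
        rfl
      · rw [mul_zero]
    · refine Submodule.sum_mem _ fun t _ => ?_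
      rw [MvPolynomial.mem_restrictDegree]
      intro m hm i
      have hm' := Finset.mem_singleton.mp (MvPolynomial.support_monomial_subset hm)
      rw [hm', ZMod.card]
      exact Nat.le_sub_one_of_lt (t.2 i).2.1
  have hcoeff := congrArg (MvPolynomial.coeff (b t₀)) hP
  rw [MvPolynomial.coeff_sum, MvPolynomial.coeff_zero, Finset.sum_eq_single t₀] at hcoeff
  · rw [MvPolynomial.coeff_monomial, if_pos rfl] at hcoeff
    exact mul_ne_zero hg₀ (hu t₀) hcoeff
  -- Within `S'` the f- and e-exponents agree, so distinct triples have distinct X-exponents and no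
  -- cancellation occurs in the coefficient at `b t₀`.
  · intro t ht hne
    obtain ⟨ht, hA, hC⟩ := Finset.mem_filter.mp ht
    rw [MvPolynomial.coeff_monomial, if_neg]
    intro hb
    exact hne (Exponents.eq_of_digitSum_eq (hr t ht) (hr t₀ ht₀) hA
      (fun i hi => DFunLike.congr_fun hb ⟨i, hi⟩) hC)
  · intro h
    exact absurd (Finset.mem_filter.mpr ⟨ht₀, rfl, rfl⟩) h

end Independence

/-! ### Distributions on Frobenius kernels -/

section FrobeniusKernel

variable {p : ℕ} [hp : Fact p.Prime]

instance : CharP (Coord (ZMod p)) p := by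
  have : Nontrivial (Coord (ZMod p)) := (counitHom (ZMod p)).toRingHom.domain_nontrivial
  exact charP_of_injective_algebraMap (algebraMap (ZMod p) (Coord (ZMod p))).injective p

variable (p) in
/-- The distributions which are semilinear over `q`-th powers of functions; for `q = p ^ r` these
are the distributions on the `r`-th Frobenius kernel. -/
def frobeniusDist (q : ℕ) : Submodule (ZMod p) (DistAlg (ZMod p)) where
  carrier := {μ | ∀ ψ φ, μ.1 (ψ ^ q * φ) = counitHom (ZMod p) ψ ^ q * μ.1 φ}
  zero_mem' := fun ψ φ => (mul_zero _).symm
  add_mem' := fun {μ ν} hμ hν ψ φ => by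
    change μ.1 _ + ν.1 _ = _ * (μ.1 _ + ν.1 _)
    rw [hμ, hν, mul_add]
  smul_mem' := fun c μ hμ ψ φ => by
    change c * μ.1 _ = _ * (c * μ.1 _)
    rw [hμ, mul_left_comm]

theorem one_mem_frobeniusDist (q : ℕ) : 1 ∈ frobeniusDist p q := fun ψ φ => by
  rw [one_dist_apply, one_dist_apply, map_mul, map_pow]

-- In characteristic `p`, the translate of ψ^{p^r} is ψ^{p^r} plus a multiple of t^{p^r}, invisible
-- to coefficients of degree below `p ^ r`.
open Polynomial in
theorem rightTranslate_coeff_frobenius {M : Matrix (Fin 2) (Fin 2) (ZMod p)[X]} (hM : M.det = 1)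
    (h0 : M.map (aeval (0 : ZMod p)) = 1) {n r : ℕ} (hn : n < p ^ r) (ψ φ : Coord (ZMod p)) :
    (rightTranslate M hM (ψ ^ p ^ r * φ)).coeff n =
      ψ ^ p ^ r * (rightTranslate M hM φ).coeff n := by
  have h := divX_mul_X_add (rightTranslate M hM ψ)
  rw [rightTranslate_coeff_zero hM h0] at h
  rw [map_mul, map_pow, ← h, add_pow_char_pow, mul_pow, add_mul, coeff_add, mul_right_comm,
    coeff_mul_X_pow', if_neg (by omega), zero_add, ← C_pow, coeff_C_mul]

theorem mul_eDiv_mem_frobeniusDist {n r : ℕ} (hn : n < p ^ r) {μ : DistAlg (ZMod p)}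
    (hμ : μ ∈ frobeniusDist p (p ^ r)) : μ * eDiv (ZMod p) n ∈ frobeniusDist p (p ^ r) := by
  intro ψ φ
  refine (conv_coeff_right _ _ n μ.1 _).trans (Eq.trans ?_
    (congrArg _ (conv_coeff_right _ _ n μ.1 φ).symm))
  rw [rightTranslate_coeff_frobenius _ _ hn, hμ]
  ext i j
  fin_cases i <;> fin_cases j <;> simp

theorem mul_fDiv_mem_frobeniusDist {n r : ℕ} (hn : n < p ^ r) {μ : DistAlg (ZMod p)}
    (hμ : μ ∈ frobeniusDist p (p ^ r)) : μ * fDiv (ZMod p) n ∈ frobeniusDist p (p ^ r) := by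
  intro ψ φ
  refine (conv_coeff_right _ _ n μ.1 _).trans (Eq.trans ?_
    (congrArg _ (conv_coeff_right _ _ n μ.1 φ).symm))
  rw [rightTranslate_coeff_frobenius _ _ hn, hμ]
  ext i j
  fin_cases i <;> fin_cases j <;> simp

theorem distMonomial_mem_frobeniusDist (r : ℕ) (a b c : ℕ → ℕ) :
    distMonomial p r a b c ∈ frobeniusDist p (p ^ r) := by
  have hmul : ∀ {ν : DistAlg (ZMod p)} (_ : ∀ μ ∈ frobeniusDist p (p ^ r),
      μ * ν ∈ frobeniusDist p (p ^ r)) (m : ℕ), ∀ μ ∈ frobeniusDist p (p ^ r),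
      μ * ν ^ m ∈ frobeniusDist p (p ^ r) := by
    intro ν hν m
    induction m with
    | zero => intro μ hμ; rwa [pow_zero, mul_one]
    | succ m ih => intro μ hμ; rw [pow_succ, ← mul_assoc]; exact hν _ (ih μ hμ)
  have hprod : ∀ {g : ℕ → DistAlg (ZMod p)} (_ : ∀ k < r, ∀ μ ∈ frobeniusDist p (p ^ r),
      μ * g k ∈ frobeniusDist p (p ^ r)) (a : ℕ → ℕ), ∀ μ ∈ frobeniusDist p (p ^ r),
      μ * orderedProd g a r ∈ frobeniusDist p (p ^ r) := by
    intro g hg a μ hμ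
    suffices H : ∀ s ≤ r, μ * orderedProd g a s ∈ frobeniusDist p (p ^ r) from H r le_rfl
    intro s
    induction s with
    | zero => intro _; rwa [orderedProd_zero, mul_one]
    | succ s ih =>
      intro hs
      rw [orderedProd_succ, ← mul_assoc]
      exact hmul (hg s hs) _ _ (ih (by omega))
  have hlt : ∀ k < r, p ^ k < p ^ r := fun k hk => Nat.pow_lt_pow_right hp.out.one_lt hk
  have hE : ∀ k < r, ∀ μ ∈ frobeniusDist p (p ^ r),
      μ * eDiv (ZMod p) (p ^ k) ∈ frobeniusDist p (p ^ r) := fun k hk μ hμ =>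
    mul_eDiv_mem_frobeniusDist (hlt k hk) hμ
  have hF : ∀ k < r, ∀ μ ∈ frobeniusDist p (p ^ r),
      μ * fDiv (ZMod p) (p ^ k) ∈ frobeniusDist p (p ^ r) := fun k hk μ hμ =>
    mul_fDiv_mem_frobeniusDist (hlt k hk) hμ
  have hX : ∀ k < r, ∀ μ ∈ frobeniusDist p (p ^ r),
      μ * xDist (ZMod p) (p ^ k) ∈ frobeniusDist p (p ^ r) := fun k hk μ hμ => by
    have := sub_mem (hF k hk _ (hE k hk μ hμ)) (hE k hk _ (hF k hk μ hμ))
    rw [mul_assoc, mul_assoc] at this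
    exact (mul_sub μ (eDiv (ZMod p) (p ^ k) * fDiv (ZMod p) (p ^ k))
      (fDiv (ZMod p) (p ^ k) * eDiv (ZMod p) (p ^ k))) ▸ this
  have h1 := hprod hE c _ (hprod hX b _ (hprod hF a 1 (one_mem_frobeniusDist _)))
  rwa [one_mul] at h1

/-- Semilinearity reduces exponents modulo `q`. Since x₀₀ equals 1 at the identity, multiplying the
argument by x₀₀^q changes nothing, which lets the determinant relation eliminate x₁₁. -/
theorem eq_zero_of_mem_frobeniusDist {q : ℕ} (hq : 0 < q) {μ : DistAlg (ZMod p)}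
    (hμ : μ ∈ frobeniusDist p q) (h : ∀ k < q, ∀ i < q, ∀ j < q,
      μ.1 (univMatrix (ZMod p) 1 0 ^ k * rowMonomial (ZMod p) i j) = 0) : μ = 0 := by
  set a := univMatrix (ZMod p) 0 0 with ha
  set b := univMatrix (ZMod p) 0 1 with hb
  set c := univMatrix (ZMod p) 1 0 with hc
  set d := univMatrix (ZMod p) 1 1 with hd
  have hdet : a * d = 1 + b * c := by
    have := univMatrix_det (ZMod p)
    rw [Matrix.det_fin_two] at this
    exact sub_eq_iff_eq_add.mp this
  have h1 : ∀ k i j, μ.1 (c ^ k * (a ^ i * b ^ j)) = 0 := by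
    intro k i j
    have hsplit : c ^ k * (a ^ i * b ^ j) = (c ^ (k / q) * (a ^ (i / q) * b ^ (j / q))) ^ q *
        (c ^ (k % q) * (a ^ (i % q) * b ^ (j % q))) := by
      conv_lhs => rw [← Nat.div_add_mod k q, ← Nat.div_add_mod i q, ← Nat.div_add_mod j q]
      ring
    rw [hsplit, hμ]
    exact mul_eq_zero_of_right _
      (h _ (Nat.mod_lt _ hq) _ (Nat.mod_lt _ hq) _ (Nat.mod_lt _ hq))
  have h2 : ∀ l k i j, μ.1 (d ^ l * (c ^ k * (a ^ i * b ^ j))) = 0 := by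
    intro l
    induction l with
    | zero => intro k i j; rw [pow_zero, one_mul, h1]
    | succ l ih =>
      intro k i j
      have ha1 : counitHom (ZMod p) a = 1 := by rw [ha, counitHom_univMatrix]; simp
      have := hμ a (d ^ (l + 1) * (c ^ k * (a ^ i * b ^ j)))
      rw [ha1, one_pow, one_mul] at this
      obtain ⟨m, rfl⟩ := Nat.exists_eq_succ_of_ne_zero hq.ne'
      -- One factor `a` of `a ^ q` pairs with one `d` through `a * d = 1 + b * c`, lowering the
      -- power of `d` by one.
      have hre : a ^ (m + 1) * (d ^ (l + 1) * (c ^ k * (a ^ i * b ^ j))) =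
          d ^ l * (c ^ k * (a ^ (m + i) * b ^ j)) +
          d ^ l * (c ^ (k + 1) * (a ^ (m + i) * b ^ (j + 1))) := by
        calc _ = (a * d) * (a ^ m * d ^ l * (c ^ k * (a ^ i * b ^ j))) := by ring
          _ = _ := by rw [hdet]; ring
      rw [← this, Nat.succ_eq_add_one, hre]
      exact (map_add μ.1.ofConv _ _).trans (by
        change μ.1 _ + μ.1 _ = 0
        rw [ih, ih, add_zero])
  have h3 : ∀ (P : MvPolynomial (Fin 2 × Fin 2) (ZMod p)) (l k i j : ℕ),
      μ.1 (Coord.mk (ZMod p) P * (d ^ l * (c ^ k * (a ^ i * b ^ j)))) = 0 := by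
    intro P
    induction P using MvPolynomial.induction_on with
    | C r =>
      intro l k i j
      rw [← MvPolynomial.algebraMap_eq, AlgHom.commutes, ← Algebra.smul_def]
      refine (map_smul μ.1.ofConv r _).trans ?_
      rw [h2, smul_zero]
    | add P Q hP hQ =>
      intro l k i j
      rw [map_add, add_mul]
      refine (map_add μ.1.ofConv _ _).trans ?_
      rw [hP, hQ, add_zero]
    | mul_X P n hP =>
      intro l k i j
      have hX : ∀ i j, Coord.mk (ZMod p) (MvPolynomial.X (i, j)) = univMatrix (ZMod p) i j :=
        fun i j => by rw [univMatrix, Matrix.map_apply, Matrix.mvPolynomialX_apply]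
      rw [map_mul (Coord.mk (ZMod p)), mul_assoc]
      obtain ⟨s, t⟩ := n
      rw [hX]
      fin_cases s <;> fin_cases t
      · convert hP l k (i + 1) j using 3
        change a * _ = _
        ring
      · convert hP l k i (j + 1) using 3
        change b * _ = _
        ring
      · convert hP l (k + 1) i j using 3
        change c * _ = _
        ring
      · convert hP (l + 1) k i j using 3
        change d * _ = _
        ring
  refine Subtype.ext ?_
  ext φ
  obtain ⟨P, rfl⟩ : ∃ P, Coord.mk (ZMod p) P = φ := Ideal.Quotient.mkₐ_surjective _ _ φ
  have := h3 P 0 0 0 0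
  simpa using this

theorem finite_frobeniusDist {q : ℕ} (hq : 0 < q) : Module.Finite (ZMod p) (frobeniusDist p q) ∧
    Module.finrank (ZMod p) (frobeniusDist p q) ≤ q * (q * q) := by
  let ev : frobeniusDist p q →ₗ[ZMod p] (Fin q × Fin q × Fin q → ZMod p) :=
    { toFun := fun μ s => μ.1.1 (univMatrix (ZMod p) 1 0 ^ (s.1 : ℕ) *
        rowMonomial (ZMod p) s.2.1 s.2.2)
      map_add' := fun _ _ => rfl
      map_smul' := fun _ _ => rfl }
  have hev : Function.Injective ev := by
    rw [injective_iff_map_eq_zero]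
    intro μ h
    exact Subtype.ext (eq_zero_of_mem_frobeniusDist hq μ.2 fun k hk i hi j hj =>
      congrFun h (⟨k, hk⟩, ⟨i, hi⟩, ⟨j, hj⟩))
  have := LinearMap.finrank_le_finrank_of_injective hev
  rw [Module.finrank_fintype_fun_eq_card] at this
  exact ⟨Module.Finite.of_injective ev hev, by simpa using this⟩

/-- If `μ` kills the (n+1)-st power of the augmentation ideal, it kills all multiples of (ψ −
ε(ψ))^{p^{n+1}} = ψ^{p^{n+1}} − ε(ψ)^{p^{n+1}}, because p^{n+1} ≥ n+1. -/
theorem exists_mem_frobeniusDist (μ : DistAlg (ZMod p)) : ∃ r, μ ∈ frobeniusDist p (p ^ r) := by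
  obtain ⟨n, hn⟩ := μ.2
  refine ⟨n + 1, fun ψ φ => ?_⟩
  have hmem : (ψ - algebraMap _ _ (counitHom (ZMod p) ψ)) ^ p ^ (n + 1) * φ ∈
      augIdeal (ZMod p) ^ (n + 1) := by
    refine Ideal.mul_mem_right _ _ (Ideal.pow_le_pow_right
      (Nat.lt_pow_self hp.out.one_lt).le (Ideal.pow_mem_pow ?_ _))
    rw [augIdeal, RingHom.mem_ker, map_sub, AlgHom.commutes, Algebra.algebraMap_self_apply,
      sub_self]
  have h := hn _ hmem
  rw [sub_pow_char_pow, sub_mul, ← map_pow, ← Algebra.smul_def] at h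
  have h' := (map_sub μ.1.ofConv _ _).symm.trans h
  rw [map_smul, sub_eq_zero] at h'
  exact h'

theorem mem_span_pbw (hrel : RelationsHold p) (μ : DistAlg (ZMod p)) :
    μ ∈ Submodule.span (ZMod p) (Set.range fun t : Exponents p =>
      presentationMap hrel (pbwMonomial p t)) := by
  obtain ⟨r, hμ⟩ := exists_mem_frobeniusDist μ
  obtain ⟨hfin, hrank⟩ := finite_frobeniusDist (p := p) (pow_pos hp.out.pos r)
  let extend : (Fin r → Fin p) → ℕ → ℕ := fun x i => if h : i < r then x ⟨i, h⟩ else 0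
  have hext : ∀ x i, extend x i < p := fun x i => by
    simp only [extend]
    split_ifs
    · exact Fin.is_lt _
    · exact hp.out.pos
  let τ : (Fin r → Fin p) × (Fin r → Fin p) × (Fin r → Fin p) → Exponents p := fun x =>
    Exponents.ofFun r (extend x.1) (extend x.2.1) (extend x.2.2) (hext _) (hext _) (hext _)
  have hτ : Function.Injective τ := by
    intro x y hxy
    have hval : ∀ {x y : Fin r → Fin p}, (∀ i < r, extend x i = extend y i) → x = y := by
      intro x y h
      funext i
      have := h i i.2
      simpa [extend, Fin.ext_iff] using this
    refine Prod.ext (hval fun i hi => ?_) (Prod.ext (hval fun i hi => ?_) (hval fun i hi => ?_))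
    · have := congrArg (fun t : Exponents p => t.1.1 i) hxy
      simp only [τ] at this
      rwa [Exponents.ofFun_fst hi, Exponents.ofFun_fst hi] at this
    · have := congrArg (fun t : Exponents p => t.1.2.1 i) hxy
      simp only [τ] at this
      rwa [Exponents.ofFun_snd hi, Exponents.ofFun_snd hi] at this
    · have := congrArg (fun t : Exponents p => t.1.2.2 i) hxy
      simp only [τ] at this
      rwa [Exponents.ofFun_trd hi, Exponents.ofFun_trd hi] at this
  let v : (Fin r → Fin p) × (Fin r → Fin p) × (Fin r → Fin p) → frobeniusDist p (p ^ r) := fun x =>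
    ⟨presentationMap hrel (pbwMonomial p (τ x)), by
      rw [presentationMap_pbwMonomial hrel Exponents.supportedBelow_ofFun]
      exact distMonomial_mem_frobeniusDist r _ _ _⟩
  have hv : LinearIndependent (ZMod p) v :=
    LinearIndependent.of_comp (frobeniusDist p (p ^ r)).subtype
      ((linearIndependent_pbw hrel).comp τ hτ)
  have hcard : Fintype.card ((Fin r → Fin p) × (Fin r → Fin p) × (Fin r → Fin p)) =
      p ^ r * (p ^ r * p ^ r) := by simp
  -- Independence makes the count p^{3r} a lower bound for the dimension, and `finite_frobeniusDist`
  -- makes it an upper bound.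
  have hspan := hv.span_eq_top_of_card_eq_finrank'
    (le_antisymm hv.fintype_card_le_finrank (hcard ▸ hrank))
  have hmem : (⟨μ, hμ⟩ : frobeniusDist p (p ^ r)) ∈ Submodule.span (ZMod p) (Set.range v) :=
    hspan ▸ Submodule.mem_top
  have := Submodule.mem_map_of_mem (f := (frobeniusDist p (p ^ r)).subtype) hmem
  rw [Submodule.map_span] at this
  refine Submodule.span_mono ?_ this
  rintro _ ⟨_, ⟨x, rfl⟩, rfl⟩
  exact ⟨τ x, rfl⟩

end FrobeniusKernel

end SL2Dist

end

theorem mainTheorem2 (p : ℕ) [Fact p.Prime] (hrel : SL2Dist.RelationsHold p) :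
    Function.Bijective (SL2Dist.presentationMap hrel) ∧
      Submodule.span (ZMod p) (Set.range (SL2Dist.pbwMonomial p)) = ⊤ ∧
      LinearIndependent (ZMod p)
        (fun t : SL2Dist.Exponents p => SL2Dist.presentationMap hrel (SL2Dist.pbwMonomial p t)) ∧
      Submodule.span (ZMod p) (Set.range fun t : SL2Dist.Exponents p =>
        SL2Dist.presentationMap hrel (SL2Dist.pbwMonomial p t)) = ⊤ := by
  have hspan := SL2Dist.span_pbwMonomial p
  have hli := SL2Dist.linearIndependent_pbw hrel
  have hspan' : Submodule.span (ZMod p) (Set.range fun t : SL2Dist.Exponents p =>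
      SL2Dist.presentationMap hrel (SL2Dist.pbwMonomial p t)) = ⊤ :=
    eq_top_iff.mpr fun μ _ => SL2Dist.mem_span_pbw hrel μ
  refine ⟨⟨?_, ?_⟩, hspan, hli, hspan'⟩
  · rw [injective_iff_map_eq_zero]
    intro w hw
    have hmem : w ∈ Submodule.span (ZMod p) (Set.range (SL2Dist.pbwMonomial p)) :=
      hspan ▸ Submodule.mem_top
    obtain ⟨l, rfl⟩ := (Finsupp.mem_span_range_iff_exists_finsupp).mp hmem
    rw [linearIndependent_iff] at hli
    have hl : l = 0 := hli l (by
      rw [Finsupp.linearCombination_apply, ← hw, Finsupp.sum, Finsupp.sum, map_sum]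
      exact Finset.sum_congr rfl fun t _ => (map_smul _ _ _).symm)
    rw [hl, Finsupp.sum_zero_index]
  · intro μ
    have hmem : μ ∈ Submodule.span (ZMod p) (Set.range fun t : SL2Dist.Exponents p =>
        SL2Dist.presentationMap hrel (SL2Dist.pbwMonomial p t)) := hspan' ▸ Submodule.mem_top
    obtain ⟨l, rfl⟩ := (Finsupp.mem_span_range_iff_exists_finsupp).mp hmem
    refine ⟨l.sum fun t c => c • SL2Dist.pbwMonomial p t, ?_⟩
    rw [Finsupp.sum, Finsupp.sum, map_sum]
    exact Finset.sum_congr rfl fun t _ => map_smul _ _ _
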